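/- Let $N,M\ge 1$, $N_0>0$, $\beta_1,\dots,\beta_M>0$ and $\alpha\in\mathbb R$. Let $\mathbf C=[\mathbf c_1,\dots,\mathbf c_M]$ be an $N\times M$ random matrix with independent $\mathcal{CN}(0,1)$ entries (non-identical Rayleigh fading: the $j$-th channel is $\sqrt{\beta_j}\,\mathbf c_j$). Fix $1\le i\le M$. Put $\hat\beta_i=\beta_i^2/(\sum_{j=1}^M\beta_j+N_0)$ and define the approximate MMSE SINR of the $i$-th stream by $$\mathrm{SINR}_i=\frac{\big((\beta_i-\hat\beta_i)\alpha^2\big)^2}{\beta_i}\;\mathbf c_i^{\mathcal H}\big(\mathbf C\,\mathrm{diag}\{\beta_j\}_{j=1}^M\mathbf C^{\mathcal H}+N_0\mathbf I_N\big)^{-1}\mathbf c_i .$$ Let $\mathbf K$ be the matrix with columns $\mathbf c_j$, $j\ne i$, let $$\Phi_i=\beta_i\,\mathbf c_i^{\mathcal H}\big(\mathbf K\,\mathrm{diag}\{\beta_j\}_{j\neq i}\mathbf K^{\mathcal H}+N_0\mathbf I_N\big)^{-1}\mathbf c_i,\qquad \kappa_i=\left(\frac{(\beta_i-\hat\beta_i)\alpha^2}{\beta_i}\right)^2,$$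 and write $F_X(x)=\Pr[X\le x]$. Then $$F_{\mathrm{SINR}_i}(x)=F_{\Phi_i}\!\left(\frac{x}{\kappa_i-x}\right)\quad (x<\kappa_i),\qquad F_{\mathrm{SINR}_i}(x)=1\quad(x\ge\kappa_i),$$ where $F_{\Phi_i}(y)=0$ for $y<0$ and, for $y\ge 0$, $$F_{\Phi_i}(y)=1-e^{-\frac{N_0}{\beta_i}y}\left[\sum_{k=1}^{N}\frac{\big(\frac{N_0}{\beta_i}y\big)^{k-1}}{(k-1)!}-\sum_{k=\max\{1,N-M+1\}}^{N}\frac{\big(\frac{N_0}{\beta_i}y\big)^{k-1}}{(k-1)!}\cdot\frac{\displaystyle\sum_{j=N-k+1}^{M}\ \sum_{\substack{1\le n_1<\cdots<n_j\le M\\ n_1,\dots,n_j\ne i}}\frac{\beta_{n_1}}{\beta_i}\cdots\frac{\beta_{n_j}}{\beta_i}\,y^{j}}{\displaystyle\prod_{n\ne i}\Big(1+\frac{\beta_n}{\beta_i}y\Big)}\right]$$ (empty sums are $0$ and empty products are $1$). When $\beta_1=\cdots=\beta_M=\beta$, this reduces, for $y\ge0$, to $$F_{\Phi_i}(y)=1-e^{-\frac{N_0}{\beta}y}\left[\sum_{k=1}^{N}\frac{\big(\frac{N_0}{\beta}y\big)^{k-1}}{(k-1)!}-\sum_{k=\max\{1,N-M+2\}}^{N}\frac{\big(\frac{N_0}{\beta}y\big)^{k-1}\sum_{j=N-k+1}^{M-1}\binom{M-1}{j}y^{j}}{(k-1)!\,(1+y)^{M-1}}\right].$$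 -/

import Mathlib

open MeasureTheory ProbabilityTheory
open scoped Matrix NNReal

noncomputable section

/-- The circularly symmetric complex Gaussian law `CN(0, v)` on `ℂ`: independent real and
imaginary parts, each with law `N(0, v / 2)`. -/
def complexGaussian (v : ℝ≥0) : Measure ℂ :=
  ((gaussianReal 0 (v / 2)).prod (gaussianReal 0 (v / 2))).map
    (fun p : ℝ × ℝ => (⟨p.1, p.2⟩ : ℂ))

/-- `C` is an `N × M` random matrix with independent `CN(0, 1)` entries (normalized Rayleigh
fading). -/
def IsRayleighMatrix {Ω : Type*} [MeasurableSpace Ω] (P : Measure Ω) {N M : ℕ}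
    (C : Ω → Matrix (Fin N) (Fin M) ℂ) : Prop :=
  (∀ a j, HasLaw (fun ω => C ω a j) (complexGaussian 1) P) ∧
    iIndepFun (fun (p : Fin N × Fin M) ω => C ω p.1 p.2) P

/-- The received covariance matrix `A = C diag(β) Cᴴ + N₀ I`. -/
def covMatrix {N M : ℕ} (β : Fin M → ℝ) (N0 : ℝ) (C : Matrix (Fin N) (Fin M) ℂ) :
    Matrix (Fin N) (Fin N) ℂ :=
  C * Matrix.diagonal (fun j => (β j : ℂ)) * Cᴴ + (N0 : ℂ) • (1 : Matrix (Fin N) (Fin N) ℂ)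

/-- The interference-plus-noise covariance matrix `K diag(β_j)_{j ≠ i} Kᴴ + N₀ I`, where `K` is
`C` without its `i`-th column. -/
def interfMatrix {N M : ℕ} (β : Fin M → ℝ) (N0 : ℝ) (i : Fin M)
    (C : Matrix (Fin N) (Fin M) ℂ) : Matrix (Fin N) (Fin N) ℂ :=
  let K : Matrix (Fin N) {j : Fin M // j ≠ i} ℂ := C.submatrix id Subtype.val
  K * Matrix.diagonal (fun j : {j : Fin M // j ≠ i} => (β j : ℂ)) * Kᴴ +
    (N0 : ℂ) • (1 : Matrix (Fin N) (Fin N) ℂ)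

/-- `cᴴ B⁻¹ c`; it is real for Hermitian `B`. -/
def invQuadForm {N : ℕ} (B : Matrix (Fin N) (Fin N) ℂ) (c : Fin N → ℂ) : ℝ :=
  (star c ⬝ᵥ (B⁻¹ *ᵥ c)).re

/-- `Φ_i = β_i c_iᴴ (K diag(β_j)_{j ≠ i} Kᴴ + N₀ I)⁻¹ c_i`. -/
def phiStat {N M : ℕ} (β : Fin M → ℝ) (N0 : ℝ) (i : Fin M)
    (C : Matrix (Fin N) (Fin M) ℂ) : ℝ :=
  β i * invQuadForm (interfMatrix β N0 i C) (fun a => C a i)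

/-- Variance `β̂_i = β_i² / (∑_j β_j + N₀)` of the channel estimation error. -/
def betaHat {M : ℕ} (β : Fin M → ℝ) (N0 : ℝ) (i : Fin M) : ℝ :=
  β i ^ 2 / (∑ j, β j + N0)

/-- The approximate MMSE SINR of stream `i`:
`((β_i - β̂_i) α²)² / β_i * c_iᴴ (C diag(β) Cᴴ + N₀ I)⁻¹ c_i`. -/
def approxSINR {N M : ℕ} (β : Fin M → ℝ) (N0 α : ℝ) (i : Fin M)
    (C : Matrix (Fin N) (Fin M) ℂ) : ℝ :=
  ((β i - betaHat β N0 i) * α ^ 2) ^ 2 / β i *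
    invQuadForm (covMatrix β N0 C) (fun a => C a i)

/-- The upper bound `((β_i - β̂_i) α² / β_i)²` of the values of the approximate SINR. -/
def sinrCeiling {M : ℕ} (β : Fin M → ℝ) (N0 α : ℝ) (i : Fin M) : ℝ :=
  ((β i - betaHat β N0 i) * α ^ 2 / β i) ^ 2

/-- The closed form of the CDF of `Φ_i` at `y ≥ 0`. The inner sum runs over the `j`-element
subsets of the indices different from `i`. The truncated subtraction in `max 1 (N + 1 - M)` agrees
with `max {1, N - M + 1}` over the integers. -/
def phiCDF (N : ℕ) {M : ℕ} (β : Fin M → ℝ) (N0 : ℝ) (i : Fin M) (y : ℝ) : ℝ :=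
  1 - Real.exp (-(N0 / β i * y)) *
    (∑ k ∈ Finset.Icc 1 N, (N0 / β i * y) ^ (k - 1) / ((k - 1).factorial : ℝ) -
      ∑ k ∈ Finset.Icc (max 1 (N + 1 - M)) N,
        (N0 / β i * y) ^ (k - 1) / ((k - 1).factorial : ℝ) *
          ((∑ j ∈ Finset.Icc (N - k + 1) M,
              ∑ S ∈ (Finset.univ.erase i).powersetCard j, (∏ n ∈ S, β n / β i) * y ^ j) /
            ∏ n ∈ Finset.univ.erase i, (1 + β n / β i * y)))

/-- The closed form of the CDF of `Φ_i` at `y ≥ 0` for identical statistics `β_1 = ⋯ = β_M = b`. -/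
def phiCDFiid (N M : ℕ) (b N0 y : ℝ) : ℝ :=
  1 - Real.exp (-(N0 / b * y)) *
    (∑ k ∈ Finset.Icc 1 N, (N0 / b * y) ^ (k - 1) / ((k - 1).factorial : ℝ) -
      ∑ k ∈ Finset.Icc (max 1 (N + 2 - M)) N,
        ((N0 / b * y) ^ (k - 1) *
            ∑ j ∈ Finset.Icc (N - k + 1) (M - 1), ((M - 1).choose j : ℝ) * y ^ j) /
          (((k - 1).factorial : ℝ) * (1 + y) ^ (M - 1)))

end

/-!
Write `B` for the interference-plus-noise matrix and `c` for the `i`-th channel. The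
Sherman–Morrison formula (`invQuadForm_add_vecMulVec`) turns the SINR into `κ Φ / (1 + Φ)`, where
`κ` is the ceiling, so the whole theorem comes down to the law of `q = cᴴ B⁻¹ c`, with `c` a
standard Gaussian vector independent of `B`.

For fixed `B`, the substitution `c = B^{1/2} u` gives
`P(q ≤ t | B) = ∫_{|u|² ≤ t} π^{-N} det B · exp(-uᴴ B u) du` (`gaussVec_quadForm_inv_le`).
Averaging over `B` first, one needs `E[det B · exp(-uᴴ B u)]`. By unitary invariance of the columns
it depends only on `r = |u|²`, and one may take `u = √r e₀`. Then the exponential is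
`e^{-N₀ r}` times a product over the columns of weights `exp(-β_n r |x_{n,0}|²)`, that is, a change
of variance in row `0` of the matrix of interferers. The expected determinant of the weighted matrix
is computed by adding the columns one at a time with the determinant lemma, simultaneously for all
principal minors (`integral_tiltedMinor_insert_succ`). Up to the factor `∏_n (1 + β_n r)⁻¹`, the
result is `m!` times the coefficient of `x^m` in
`e^{N₀ x} (N₀ ∏_n (1 + β_n x) + ∑_n β_n / (1 + β_n r) ∏_{k ≠ n} (1 + β_k x))`, where `N = m + 1`
(`integral_tiltedMinor_of_mem_range`).

Integrating over the ball in polar form, `q` has the density `tailDensity`, and a recursion on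
the set of interferers shows that this is minus the derivative of `tailFun`, the truncation of
`e^{N₀ x} ∏_n (1 + β_n x)` to degrees below `N`, taken at `x = t` and divided by its untruncated
value (`hasDerivAt_tailFun`). Equivalently, `P(q > t)` is the probability that a
Poisson variable of mean `N₀ t` plus independent Bernoulli variables of parameters
`β_n t / (1 + β_n t)` is less than `N`. Expanding the truncation gives the two closed forms.
-/

noncomputable section

/-! ### Coefficients of the generating function and the tail function -/

section Coefficients

variable {ι : Type*}

/-- The `j`-th elementary symmetric polynomial in the numbers `β n`, `n ∈ S`. -/
def elemSymm (β : ι → ℝ) (S : Finset ι) (j : ℕ) : ℝ :=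
  ∑ U ∈ S.powersetCard j, ∏ n ∈ U, β n

@[simp] lemma elemSymm_zero (β : ι → ℝ) (S : Finset ι) : elemSymm β S 0 = 1 := by
  simp [elemSymm]

lemma elemSymm_empty_succ (β : ι → ℝ) (j : ℕ) : elemSymm β ∅ (j + 1) = 0 := by
  rw [elemSymm, Finset.powersetCard_eq_empty.2 (by simp), Finset.sum_empty]

lemma elemSymm_eq_zero (β : ι → ℝ) {S : Finset ι} {j : ℕ} (h : S.card < j) :
    elemSymm β S j = 0 := by
  simp [elemSymm, Finset.powersetCard_eq_empty.2 h]

lemma elemSymm_insert_succ [DecidableEq ι] (β : ι → ℝ) {S : Finset ι} {n : ι} (hn : n ∉ S) (j : ℕ) :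
    elemSymm β (insert n S) (j + 1) = elemSymm β S (j + 1) + β n * elemSymm β S j := by
  have hU : ∀ U ∈ S.powersetCard j, n ∉ U := fun U hU h =>
    hn ((Finset.mem_powersetCard.1 hU).1 h)
  rw [elemSymm, Finset.powersetCard_succ_insert hn, Finset.sum_union, Finset.sum_image,
    elemSymm, elemSymm, Finset.mul_sum]
  · exact congrArg _ (Finset.sum_congr rfl fun U h => Finset.prod_insert (hU U h))
  · intro U h V h' e
    rw [← Finset.erase_insert (hU U h), ← Finset.erase_insert (hU V h'), e]
  · rw [Finset.disjoint_left]
    intro U h h'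
    obtain ⟨V, -, rfl⟩ := Finset.mem_image.1 h'
    exact hn ((Finset.mem_powersetCard.1 h).1 (Finset.mem_insert_self _ _))

/-- The coefficient of `x ^ m` in `exp (N0 * x) * ∏ n ∈ S, (1 + β n * x)`. -/
def genCoeff (β : ι → ℝ) (N0 : ℝ) (S : Finset ι) (m : ℕ) : ℝ :=
  ∑ p ∈ Finset.HasAntidiagonal.antidiagonal m, N0 ^ p.1 / (p.1.factorial : ℝ) * elemSymm β S p.2

lemma genCoeff_empty (β : ι → ℝ) (N0 : ℝ) (m : ℕ) :
    genCoeff β N0 ∅ m = N0 ^ m / (m.factorial : ℝ) := by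
  cases m with
  | zero => simp [genCoeff]
  | succ m =>
    rw [genCoeff, Finset.Nat.antidiagonal_succ']
    simp [elemSymm_empty_succ]

@[simp] lemma genCoeff_zero (β : ι → ℝ) (N0 : ℝ) (S : Finset ι) : genCoeff β N0 S 0 = 1 := by
  simp [genCoeff]

lemma genCoeff_insert_succ [DecidableEq ι] (β : ι → ℝ) (N0 : ℝ) {S : Finset ι} {n : ι} (hn : n ∉ S)
    (m : ℕ) : genCoeff β N0 (insert n S) (m + 1) =
      genCoeff β N0 S (m + 1) + β n * genCoeff β N0 S m := by
  simp only [genCoeff, Finset.Nat.antidiagonal_succ', Finset.sum_cons, Finset.sum_map,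
    Function.Embedding.prodMap, Function.Embedding.coeFn_mk, Prod.map,
    Function.Embedding.refl_apply,
    Nat.succ_eq_add_one, elemSymm_insert_succ β hn, elemSymm_zero, mul_add, Finset.sum_add_distrib,
    Finset.mul_sum]
  rw [add_assoc]
  congr 2
  exact Finset.sum_congr rfl fun _ _ => by ring

variable [DecidableEq ι]

/-- The coefficient of `x ^ m` in `exp (N0 * x)` times
`N0 * ∏ n ∈ S, (1 + β n * x) + ∑ n ∈ S, β n / (1 + β n * r) * ∏ k ∈ S \ {n}, (1 + β k * x)`. -/
def tiltCoeff (β : ι → ℝ) (N0 r : ℝ) (S : Finset ι) (m : ℕ) : ℝ :=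
  N0 * genCoeff β N0 S m + ∑ n ∈ S, β n / (1 + β n * r) * genCoeff β N0 (S.erase n) m

lemma tiltCoeff_empty (β : ι → ℝ) (N0 r : ℝ) (m : ℕ) :
    tiltCoeff β N0 r ∅ m = N0 ^ (m + 1) / (m.factorial : ℝ) := by
  simp [tiltCoeff, genCoeff_empty]; ring

lemma tiltCoeff_insert_zero (β : ι → ℝ) (N0 r : ℝ) {S : Finset ι} {n : ι} (hn : n ∉ S) :
    tiltCoeff β N0 r (insert n S) 0 = tiltCoeff β N0 r S 0 + β n / (1 + β n * r) := by
  simp [tiltCoeff, Finset.sum_insert hn]; ring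

lemma tiltCoeff_insert_succ (β : ι → ℝ) (N0 r : ℝ) {S : Finset ι} {n : ι} (hn : n ∉ S) (m : ℕ) :
    tiltCoeff β N0 r (insert n S) (m + 1) = tiltCoeff β N0 r S (m + 1) +
      β n * tiltCoeff β N0 r S m + β n / (1 + β n * r) * genCoeff β N0 S (m + 1) := by
  have h : ∀ k ∈ S, β k / (1 + β k * r) * genCoeff β N0 ((insert n S).erase k) (m + 1) =
      β k / (1 + β k * r) * genCoeff β N0 (S.erase k) (m + 1) +
        β n * (β k / (1 + β k * r) * genCoeff β N0 (S.erase k) m) := by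
    intro k hk
    have hkn : n ≠ k := fun e => hn (e ▸ hk)
    rw [Finset.erase_insert_of_ne hkn,
      genCoeff_insert_succ β N0 (fun e => hn (Finset.mem_of_mem_erase e))]
    ring
  rw [tiltCoeff, Finset.sum_insert hn, Finset.erase_insert hn, Finset.sum_congr rfl h,
    Finset.sum_add_distrib, ← Finset.mul_sum, genCoeff_insert_succ β N0 hn, tiltCoeff, tiltCoeff]
  ring

/-- The probability that the quadratic form in dimension `N` with interferers `S` exceeds `t`: the
generating function `exp (N0 * x) * ∏ n ∈ S, (1 + β n * x)` truncated to degrees below `N` and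
normalized, at `x = t`. -/
def tailFun (β : ι → ℝ) (N0 : ℝ) (S : Finset ι) (N : ℕ) (t : ℝ) : ℝ :=
  Real.exp (-(N0 * t)) * (∑ m ∈ Finset.range N, genCoeff β N0 S m * t ^ m) /
    ∏ n ∈ S, (1 + β n * t)

/-- The density at `t` of the quadratic form in dimension `m + 1` with interferers `S`. -/
def tailDensity (β : ι → ℝ) (N0 : ℝ) (S : Finset ι) (m : ℕ) (t : ℝ) : ℝ :=
  t ^ m * Real.exp (-(N0 * t)) * tiltCoeff β N0 t S m / ∏ n ∈ S, (1 + β n * t)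

omit [DecidableEq ι] in
lemma tailFun_zero (β : ι → ℝ) (N0 : ℝ) (S : Finset ι) (t : ℝ) : tailFun β N0 S 0 t = 0 := by
  simp [tailFun]

omit [DecidableEq ι] in
lemma tailFun_succ (β : ι → ℝ) (N0 : ℝ) (S : Finset ι) (N : ℕ) (t : ℝ) :
    tailFun β N0 S (N + 1) t = tailFun β N0 S N t +
      Real.exp (-(N0 * t)) * (genCoeff β N0 S N * t ^ N) / ∏ n ∈ S, (1 + β n * t) := by
  rw [tailFun, tailFun, Finset.sum_range_succ]; ring

lemma sum_genCoeff_insert (β : ι → ℝ) (N0 : ℝ) {S : Finset ι} {n : ι} (hn : n ∉ S) (N : ℕ)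
    (t : ℝ) : ∑ m ∈ Finset.range (N + 1), genCoeff β N0 (insert n S) m * t ^ m =
      ∑ m ∈ Finset.range (N + 1), genCoeff β N0 S m * t ^ m +
        β n * t * ∑ m ∈ Finset.range N, genCoeff β N0 S m * t ^ m := by
  rw [Finset.sum_range_succ', Finset.sum_range_succ' _ N, Finset.mul_sum, add_right_comm,
    ← Finset.sum_add_distrib]
  simp only [genCoeff_zero]
  congr 1
  exact Finset.sum_congr rfl fun m _ => by rw [genCoeff_insert_succ β N0 hn]; ring

/-- An additional interferer of power `β n` replaces the dimension `N + 1` by a random dimension,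
which is `N` with probability `β n * t / (1 + β n * t)`. -/
lemma tailFun_insert (β : ι → ℝ) (N0 : ℝ) {S : Finset ι} {n : ι} (hn : n ∉ S) (N : ℕ) (t : ℝ) :
    tailFun β N0 (insert n S) (N + 1) t =
      (tailFun β N0 S (N + 1) t + β n * t * tailFun β N0 S N t) / (1 + β n * t) := by
  rw [tailFun, sum_genCoeff_insert β N0 hn, Finset.prod_insert hn, tailFun, tailFun,
    mul_comm (1 + β n * t),
    ← div_div]
  ring

/-- Induction on the interferers: `tailFun_insert` and the recursions of `tiltCoeff` on `insert` are
compatible with differentiation. -/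
lemma hasDerivAt_tailFun {β : ι → ℝ} (hβ : ∀ n, 0 ≤ β n) (N0 : ℝ) (S : Finset ι) (N : ℕ) {t : ℝ}
    (ht : 0 ≤ t) : HasDerivAt (tailFun β N0 S (N + 1)) (-tailDensity β N0 S N t) t := by
  induction S using Finset.induction_on generalizing N with
  | empty =>
    have hexp : HasDerivAt (fun t => Real.exp (-(N0 * t))) (-(Real.exp (-(N0 * t)) * N0)) t := by
      have := (((hasDerivAt_id t).const_mul N0).neg).exp
      simpa using this
    induction N with
    | zero =>
      have e : tailFun β N0 ∅ (0 + 1) = fun t => Real.exp (-(N0 * t)) := by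
        funext s; simp [tailFun]
      rw [e]
      convert! hexp using 1
      simp [tailDensity, tiltCoeff_empty]
    | succ N ih =>
      have e : tailFun β N0 ∅ (N + 1 + 1) = fun t => tailFun β N0 ∅ (N + 1) t +
          N0 ^ (N + 1) / ((N + 1).factorial : ℝ) * (Real.exp (-(N0 * t)) * t ^ (N + 1)) := by
        funext s
        rw [tailFun_succ, genCoeff_empty]
        simp; ring
      rw [e]
      have hd := ih.add ((hexp.mul (hasDerivAt_pow (N + 1) t)).const_mul
        (N0 ^ (N + 1) / ((N + 1).factorial : ℝ)))
      convert! hd using 1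
      have h1 : (N.factorial : ℝ) ≠ 0 := by positivity
      have h2 : (N : ℝ) + 1 ≠ 0 := by positivity
      simp only [tailDensity, tiltCoeff_empty, Finset.prod_empty, div_one, Nat.factorial_succ]
      push_cast
      field_simp
      ring
  | insert n S hn ih =>
    have hpos : 0 < 1 + β n * t := by have := mul_nonneg (hβ n) ht; linarith
    have hprod : ∏ k ∈ S, (1 + β k * t) ≠ 0 :=
      (Finset.prod_pos fun k _ => by have := mul_nonneg (hβ k) ht; linarith).ne'
    have hlin : HasDerivAt (fun t => β n * t) (β n) t := by
      simpa using (hasDerivAt_id t).const_mul (β n)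
    have e : tailFun β N0 (insert n S) (N + 1) = fun t =>
        (tailFun β N0 S (N + 1) t + β n * t * tailFun β N0 S N t) / (1 + β n * t) := by
      funext s; exact tailFun_insert β N0 hn N s
    rw [e]
    cases N with
    | zero =>
      have hd := (ih 0).div (hlin.const_add 1) hpos.ne'
      simp only [tailFun_zero, mul_zero, add_zero]
      convert! hd using 1
      simp only [tailDensity, tailFun_succ, tailFun_zero, tiltCoeff_insert_zero _ _ _ hn,
        Finset.prod_insert hn, genCoeff_zero, pow_zero]
      have hc := hpos.ne'
      generalize ∏ k ∈ S, (1 + β k * t) = p at hprod ⊢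
      generalize hcd : 1 + β n * t = c at hc ⊢
      field_simp
      rw [← hcd]
      ring
    | succ N =>
      have hd := (((ih (N + 1)).add (hlin.mul (ih N))).div (hlin.const_add 1) hpos.ne')
      convert! hd using 1
      simp only [Pi.add_apply, Pi.mul_apply, tailFun_succ _ _ _ (N + 1), tailDensity,
        tiltCoeff_insert_succ _ _ _ hn, Finset.prod_insert hn]
      generalize tailFun β N0 S (N + 1) t = F
      have hc := hpos.ne'
      generalize ∏ k ∈ S, (1 + β k * t) = p at hprod ⊢
      generalize hcd : 1 + β n * t = c at hc ⊢
      field_simp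
      rw [← hcd]
      ring

end Coefficients

/-! ### The closed forms of the distribution function -/

section ClosedForm

lemma sum_range_sum_antidiagonal (c d : ℕ → ℝ) (N : ℕ) :
    ∑ m ∈ Finset.range N, ∑ p ∈ Finset.HasAntidiagonal.antidiagonal m, c p.1 * d p.2 =
      ∑ k ∈ Finset.range N, c k * ∑ j ∈ Finset.range (N - k), d j := by
  induction N with
  | zero => simp
  | succ N ih =>
    rw [Finset.sum_range_succ, ih, Finset.Nat.sum_antidiagonal_eq_sum_range_succ_mk,
      Finset.sum_range_succ, Finset.sum_range_succ _ N, ← add_assoc, ← Finset.sum_add_distrib]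
    congr 1
    · refine Finset.sum_congr rfl fun k hk => ?_
      rw [Nat.succ_sub (Finset.mem_range.1 hk).le, Finset.sum_range_succ, mul_add]
    · simp

/-- The expansion of `∏ n ∈ S, (1 + β n * t)` by degree, split at degree `q`. -/
lemma sum_elemSymm_mul_pow {ι : Type*} (β : ι → ℝ) (S : Finset ι) (t : ℝ) {q M : ℕ}
    (hM : S.card ≤ M) :
    ∑ j ∈ Finset.range q, elemSymm β S j * t ^ j + ∑ j ∈ Finset.Icc q M, elemSymm β S j * t ^ j =
      ∏ n ∈ S, (1 + β n * t) := by
  classical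
  have hprod : ∏ n ∈ S, (1 + β n * t) =
      ∑ j ∈ Finset.range (S.card + 1), elemSymm β S j * t ^ j := by
    rw [Finset.prod_one_add, Finset.sum_powerset]
    refine Finset.sum_congr rfl fun j _ => ?_
    rw [elemSymm, Finset.sum_mul]
    refine Finset.sum_congr rfl fun U hU => ?_
    rw [Finset.prod_mul_distrib, Finset.prod_const, (Finset.mem_powersetCard.1 hU).2]
  rw [hprod, ← Finset.sum_union]
  · symm
    apply Finset.sum_subset
    · intro j hj
      simp only [Finset.mem_range, Finset.mem_union, Finset.mem_Icc] at hj ⊢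
      omega
    · intro j _ hj
      rw [elemSymm_eq_zero β (by simpa using hj), zero_mul]
  · rw [Finset.disjoint_left]
    intro j hj hj'
    simp only [Finset.mem_range, Finset.mem_Icc] at hj hj'
    omega

lemma tailFun_eq {ι : Type*} {β : ι → ℝ} (N0 : ℝ) {S : Finset ι} (N : ℕ) {M : ℕ}
    (hM : S.card ≤ M) {t : ℝ} (hS : ∏ n ∈ S, (1 + β n * t) ≠ 0) :
    tailFun β N0 S N t = Real.exp (-(N0 * t)) *
      (∑ k ∈ Finset.range N, (N0 * t) ^ k / (k.factorial : ℝ) -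
        ∑ k ∈ Finset.range N, (N0 * t) ^ k / (k.factorial : ℝ) *
          ((∑ j ∈ Finset.Icc (N - k) M, elemSymm β S j * t ^ j) / ∏ n ∈ S, (1 + β n * t))) := by
  have h : ∑ m ∈ Finset.range N, genCoeff β N0 S m * t ^ m =
      ∑ k ∈ Finset.range N, (N0 * t) ^ k / (k.factorial : ℝ) *
        ∑ j ∈ Finset.range (N - k), elemSymm β S j * t ^ j := by
    rw [← sum_range_sum_antidiagonal (fun k => (N0 * t) ^ k / (k.factorial : ℝ))
      (fun j => elemSymm β S j * t ^ j)]
    refine Finset.sum_congr rfl fun m _ => ?_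
    rw [genCoeff, Finset.sum_mul]
    refine Finset.sum_congr rfl fun p hp => ?_
    rw [← Finset.HasAntidiagonal.mem_antidiagonal.1 hp]
    ring
  rw [tailFun, h, mul_div_assoc, Finset.sum_div, ← Finset.sum_sub_distrib]
  congr 1
  refine Finset.sum_congr rfl fun k _ => ?_
  rw [← sum_elemSymm_mul_pow β S t (q := N - k) hM] at hS ⊢
  field_simp
  ring

lemma sum_Icc_one_eq_sum_range (f : ℕ → ℝ) (N : ℕ) :
    ∑ k ∈ Finset.Icc 1 N, f k = ∑ k ∈ Finset.range N, f (k + 1) := by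
  rw [Finset.range_eq_Ico, Finset.sum_Ico_add' f 0 N 1]
  rfl

lemma sum_Icc_max_one_eq (f : ℕ → ℝ) {N q : ℕ} (h : ∀ k, k < q → k ≤ N → 1 ≤ k → f k = 0) :
    ∑ k ∈ Finset.Icc (max 1 q) N, f k = ∑ k ∈ Finset.range N, f (k + 1) := by
  rw [← sum_Icc_one_eq_sum_range]
  apply Finset.sum_subset
  · exact Finset.Icc_subset_Icc (le_max_left _ _) le_rfl
  · intro k hk hk'
    simp only [Finset.mem_Icc] at hk hk'
    exact h k (by omega) hk.2 hk.1

lemma phiCDF_eq_tailFun (N : ℕ) {M : ℕ} {β : Fin M → ℝ} (hβ : ∀ j, 0 < β j) (N0 : ℝ) (i : Fin M)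
    {y : ℝ} (hy : 0 ≤ y) :
    phiCDF N β N0 i y = 1 - tailFun β N0 (Finset.univ.erase i) N (y / β i) := by
  have hS : ∏ n ∈ Finset.univ.erase i, (1 + β n * (y / β i)) ≠ 0 :=
    (Finset.prod_pos fun n _ => by have := hβ n; have := hβ i; positivity).ne'
  have hcard : (Finset.univ.erase i).card ≤ M := by simp
  have hterm : ∀ k j : ℕ, ∑ S ∈ (Finset.univ.erase i).powersetCard j, (∏ n ∈ S, β n / β i) * y ^ j =
      elemSymm β (Finset.univ.erase i) j * (y / β i) ^ j := by
    intro _ j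
    rw [elemSymm, Finset.sum_mul]
    refine Finset.sum_congr rfl fun U hU => ?_
    rw [Finset.prod_div_distrib, Finset.prod_const, (Finset.mem_powersetCard.1 hU).2, div_pow]
    ring
  rw [phiCDF, tailFun_eq N0 N hcard hS, sum_Icc_one_eq_sum_range, sum_Icc_max_one_eq]
  · simp only [Nat.add_sub_cancel]
    have e1 : N0 / β i * y = N0 * (y / β i) := by ring
    have e2 : ∀ n, β n / β i * y = β n * (y / β i) := fun n => by ring
    simp only [e1, e2]
    congr 3
    refine Finset.sum_congr rfl fun k hk => ?_
    rw [Finset.sum_congr rfl fun j _ => hterm k j]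
    have : N - (k + 1) + 1 = N - k := by have := Finset.mem_range.1 hk; omega
    rw [this]
  · intro k hk hk' _
    rw [Finset.Icc_eq_empty (by omega)]
    simp

lemma phiCDF_eq_phiCDFiid (N : ℕ) {M : ℕ} {β : Fin M → ℝ} {b : ℝ} (hb : b ≠ 0)
    (hβ : ∀ j, β j = b) (N0 : ℝ) (i : Fin M) (y : ℝ) :
    phiCDF N β N0 i y = phiCDFiid N M b N0 y := by
  have hM : 0 < M := i.pos
  have hsum : ∀ q : ℕ, ∑ j ∈ Finset.Icc q M, ∑ S ∈ (Finset.univ.erase i).powersetCard j,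
      (∏ n ∈ S, β n / β i) * y ^ j =
      ∑ j ∈ Finset.Icc q (M - 1), ((M - 1).choose j : ℝ) * y ^ j := by
    intro q
    have h1 : ∀ j, ∑ S ∈ (Finset.univ.erase i).powersetCard j, (∏ n ∈ S, β n / β i) * y ^ j =
        ((M - 1).choose j : ℝ) * y ^ j := by
      intro j
      simp [hβ, div_self hb]
    rw [Finset.sum_congr rfl fun j _ => h1 j]
    symm
    apply Finset.sum_subset (Finset.Icc_subset_Icc le_rfl (Nat.sub_le _ _))
    intro j hj hj'
    simp only [Finset.mem_Icc] at hj hj'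
    rw [Nat.choose_eq_zero_of_lt (by omega)]
    simp
  rw [phiCDF, phiCDFiid, sum_Icc_max_one_eq, sum_Icc_max_one_eq]
  · simp only [hsum]
    simp only [hβ, div_self hb, one_mul, Finset.prod_const, Finset.card_erase_of_mem
      (Finset.mem_univ i), Finset.card_univ, Fintype.card_fin]
    congr 3
    exact Finset.sum_congr rfl fun k _ => by rw [div_mul_div_comm]
  · intro k _ _ _
    rw [Finset.Icc_eq_empty (by omega)]
    simp
  · intro k _ _ _
    rw [Finset.Icc_eq_empty (by omega)]
    simp

end ClosedForm

/-! ### Gaussian vectors: density, linear changes of variables and radial integration -/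

section GaussianVectors

lemma gaussianPDF_mul_gaussianPDF_half (x y : ℝ) :
    gaussianPDF 0 (1 / 2) x * gaussianPDF 0 (1 / 2) y =
      ENNReal.ofReal (Real.pi⁻¹ * Real.exp (-‖(⟨x, y⟩ : ℂ)‖ ^ 2)) := by
  rw [gaussianPDF, gaussianPDF, ← ENNReal.ofReal_mul (gaussianPDFReal_nonneg _ _ _),
    gaussianPDFReal, gaussianPDFReal, mul_mul_mul_comm, ← Real.exp_add]
  congr 2
  · rw [← mul_inv, ← Real.sqrt_mul (by positivity), Real.sqrt_mul_self (by positivity)]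
    simp only [NNReal.coe_div, NNReal.coe_one, NNReal.coe_ofNat]
    congr 1
    ring
  · congr 1
    rw [← Complex.normSq_eq_norm_sq, Complex.normSq_mk]
    simp only [sub_zero, NNReal.coe_div, NNReal.coe_one, NNReal.coe_ofNat]
    ring

lemma complexGaussian_one_eq_withDensity :
    complexGaussian 1 =
      volume.withDensity (fun z : ℂ => ENNReal.ofReal (Real.pi⁻¹ * Real.exp (-‖z‖ ^ 2))) := by
  have hv : (1 / 2 : ℝ≥0) ≠ 0 := by simp
  have hmp := Complex.volume_preserving_equiv_real_prod.symm
  have he : (fun p : ℝ × ℝ => (⟨p.1, p.2⟩ : ℂ)) = Complex.measurableEquivRealProd.symm := by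
    funext p; rfl
  rw [complexGaussian, gaussianReal_of_var_ne_zero 0 hv,
    prod_withDensity (measurable_gaussianPDF _ _) (measurable_gaussianPDF _ _), he,
    ← Measure.volume_eq_prod]
  ext s hs
  rw [Measure.map_apply hmp.measurable hs, withDensity_apply _ (hmp.measurable hs),
    withDensity_apply _ hs,
    ← hmp.setLIntegral_comp_preimage_emb (MeasurableEquiv.measurableEmbedding _)]
  refine lintegral_congr fun p => ?_
  exact gaussianPDF_mul_gaussianPDF_half p.1 p.2

instance (v : ℝ≥0) : IsProbabilityMeasure (complexGaussian v) :=
  Measure.isProbabilityMeasure_map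
    (Complex.measurableEquivRealProd.symm.measurable.aemeasurable : AEMeasurable
      (fun p : ℝ × ℝ => (⟨p.1, p.2⟩ : ℂ)) _)

/-- A product of copies of a measure with integrable density has the product density. -/
lemma pi_withDensity_ofReal {κ E : Type*} [Fintype κ] [MeasureSpace E]
    [SigmaFinite (volume : Measure E)] {f : E → ℝ} (hf : Integrable f) (hf0 : ∀ x, 0 ≤ f x) :
    Measure.pi (fun _ : κ => (volume : Measure E).withDensity fun x => ENNReal.ofReal (f x)) =
      (volume : Measure (κ → E)).withDensity fun x => ENNReal.ofReal (∏ a, f (x a)) := by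
  have : IsFiniteMeasure ((volume : Measure E).withDensity fun x => ENNReal.ofReal (f x)) :=
    isFiniteMeasure_withDensity_ofReal hf.2
  refine Measure.pi_eq fun s hs => ?_
  have hind : ∀ x : κ → E, (Set.univ.pi s).indicator (fun x => ENNReal.ofReal (∏ a, f (x a))) x =
      ENNReal.ofReal (∏ a, (s a).indicator f (x a)) := by
    intro x
    by_cases hx : x ∈ Set.univ.pi s
    · rw [Set.indicator_of_mem hx]
      congr 1
      exact Finset.prod_congr rfl fun a _ => by rw [Set.indicator_of_mem (hx a trivial)]
    · rw [Set.indicator_of_notMem hx]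
      obtain ⟨a, ha⟩ : ∃ a, x a ∉ s a := by simpa [Set.mem_pi] using hx
      rw [Finset.prod_eq_zero (Finset.mem_univ a) (Set.indicator_of_notMem ha f)]
      simp
  have hint : ∀ a, Integrable ((s a).indicator f) := fun a => hf.indicator (hs a)
  have hI : Integrable (fun x : κ → E => ∏ a, (s a).indicator f (x a)) :=
    Integrable.fintype_prod hint
  have hnn : ∀ a x, 0 ≤ (s a).indicator f x := fun a x => Set.indicator_nonneg (fun x _ => hf0 x) x
  rw [withDensity_apply _ (MeasurableSet.univ_pi hs),
    ← lintegral_indicator (MeasurableSet.univ_pi hs),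
    lintegral_congr hind, ← ofReal_integral_eq_lintegral_ofReal hI
      (Filter.Eventually.of_forall fun x => Finset.prod_nonneg fun a _ => hnn a _),
    integral_fintype_prod_volume_eq_prod (fun a => (s a).indicator f),
    ENNReal.ofReal_prod_of_nonneg fun a _ => integral_nonneg (hnn a)]
  refine Finset.prod_congr rfl fun a _ => ?_
  rw [withDensity_apply _ (hs a), ← lintegral_indicator (hs a),
    ofReal_integral_eq_lintegral_ofReal (hint a) (Filter.Eventually.of_forall (hnn a))]
  refine lintegral_congr fun x => ?_
  by_cases hx : x ∈ s a <;> simp [hx]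

/-- The law of a vector indexed by `κ` with independent `CN(0, 1)` entries. -/
def gaussVec (κ : Type*) [Fintype κ] : Measure (κ → ℂ) := Measure.pi fun _ => complexGaussian 1

instance (κ : Type*) [Fintype κ] : IsProbabilityMeasure (gaussVec κ) := by
  unfold gaussVec; infer_instance

variable {κ : Type*} [Fintype κ]

lemma integrable_exp_neg_norm_sq : Integrable fun z : ℂ => Real.pi⁻¹ * Real.exp (-‖z‖ ^ 2) := by
  refine ⟨by fun_prop, ?_⟩
  have h : (complexGaussian 1) Set.univ < ⊤ := measure_lt_top _ _
  rw [complexGaussian_one_eq_withDensity, withDensity_apply _ .univ, Measure.restrict_univ] at h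
  rwa [hasFiniteIntegral_iff_ofReal (Filter.Eventually.of_forall fun z => by positivity)]

/-- The density of `gaussVec κ` with respect to Lebesgue measure. -/
def gaussDensity (z : κ → ℂ) : ℝ :=
  (Real.pi ^ Fintype.card κ)⁻¹ * Real.exp (-∑ a, ‖z a‖ ^ 2)

lemma gaussVec_eq_withDensity :
    gaussVec κ = volume.withDensity fun z => ENNReal.ofReal (gaussDensity z) := by
  rw [gaussVec, complexGaussian_one_eq_withDensity,
    pi_withDensity_ofReal integrable_exp_neg_norm_sq fun z => by positivity]
  congr 1
  funext z
  rw [Finset.prod_mul_distrib, Finset.prod_const, ← Real.exp_sum, Finset.sum_neg_distrib,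
    gaussDensity, Finset.card_univ, inv_pow]

lemma measurable_gaussDensity : Measurable (gaussDensity : (κ → ℂ) → ℝ) := by
  unfold gaussDensity; fun_prop

lemma lintegral_gaussVec {f : (κ → ℂ) → ENNReal} (hf : Measurable f) :
    ∫⁻ z, f z ∂gaussVec κ = ∫⁻ z, ENNReal.ofReal (gaussDensity z) * f z := by
  rw [gaussVec_eq_withDensity, lintegral_withDensity_eq_lintegral_mul _
    measurable_gaussDensity.ennreal_ofReal hf]
  rfl

variable [DecidableEq κ]

/-- The real Jacobian of a complex linear map is the squared modulus of its complex determinant. -/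
lemma lintegral_comp_mulVec {L : Matrix κ κ ℂ} (hL : L.det ≠ 0) (f : (κ → ℂ) → ENNReal)
    (hf : Measurable f) :
    ∫⁻ z, f z = ENNReal.ofReal (‖L.det‖ ^ 2) * ∫⁻ u, f (L *ᵥ u) := by
  have hdet : LinearMap.det (L.toLin'.restrictScalars ℝ) = ‖L.det‖ ^ 2 := by
    rw [LinearMap.det_restrictScalars, LinearMap.det_toLin', Algebra.norm_complex_apply,
      Complex.normSq_eq_norm_sq]
  have hpos : 0 < ‖L.det‖ ^ 2 := by positivity
  have hne : LinearMap.det (L.toLin'.restrictScalars ℝ) ≠ 0 := by rw [hdet]; exact hpos.ne'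
  have hmeas : Measurable (L.toLin'.restrictScalars ℝ) :=
    (LinearMap.continuous_of_finiteDimensional _).measurable
  have h := Measure.map_linearMap_addHaar_eq_smul_addHaar (volume : Measure (κ → ℂ)) hne
  have h2 : ∫⁻ u, f (L *ᵥ u) = ENNReal.ofReal (‖L.det‖ ^ 2)⁻¹ * ∫⁻ z, f z := by
    rw [← abs_of_pos (inv_pos.2 hpos), ← hdet, ← smul_eq_mul, ← lintegral_smul_measure, ← h,
      lintegral_map hf hmeas]
    rfl
  rw [h2, ← mul_assoc, ← ENNReal.ofReal_mul hpos.le, mul_inv_cancel₀ hpos.ne']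
  simp

omit [DecidableEq κ] in
lemma sum_norm_sq_eq (z : κ → ℂ) : ((∑ a, ‖z a‖ ^ 2 : ℝ) : ℂ) = star z ⬝ᵥ z := by
  simp [dotProduct, Complex.conj_mul']

omit [DecidableEq κ] in
lemma sum_norm_sq_mulVec (L : Matrix κ κ ℂ) (z : κ → ℂ) :
    ((∑ a, ‖(L *ᵥ z) a‖ ^ 2 : ℝ) : ℂ) = star z ⬝ᵥ ((Lᴴ * L) *ᵥ z) := by
  rw [sum_norm_sq_eq, Matrix.star_mulVec, ← Matrix.dotProduct_mulVec, Matrix.mulVec_mulVec]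

lemma measurePreserving_mulVec_gaussVec {U : Matrix κ κ ℂ} (hU : U ∈ Matrix.unitaryGroup κ ℂ) :
    MeasurePreserving (fun z => U *ᵥ z) (gaussVec κ) (gaussVec κ) := by
  have hUU : Uᴴ * U = 1 := Matrix.mem_unitaryGroup_iff'.1 hU
  have hn : ‖U.det‖ = 1 := by
    have := congrArg (fun A => ‖Matrix.det A‖) hUU
    simp only [Matrix.det_mul, Matrix.det_conjTranspose, norm_mul, norm_star, Matrix.det_one,
      norm_one] at this
    nlinarith [norm_nonneg U.det]
  have hm : Measurable fun z => U *ᵥ z :=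
    (Continuous.matrix_mulVec continuous_const continuous_id).measurable
  refine ⟨hm, ?_⟩
  ext s hs
  have hdens : ∀ z, gaussDensity (U *ᵥ z) = gaussDensity z := by
    intro z
    have : ∑ a, ‖(U *ᵥ z) a‖ ^ 2 = ∑ a, ‖z a‖ ^ 2 := by
      have := sum_norm_sq_mulVec U z
      rw [hUU, Matrix.one_mulVec, ← sum_norm_sq_eq] at this
      exact_mod_cast this
    rw [gaussDensity, gaussDensity, this]
  rw [Measure.map_apply hm hs, ← lintegral_indicator_one hs, ← lintegral_indicator_one (hm hs),
    lintegral_gaussVec (measurable_one.indicator (hm hs)),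
    lintegral_gaussVec (measurable_one.indicator hs),
    lintegral_comp_mulVec (L := U) (by rw [← norm_pos_iff, hn]; exact one_pos)
      (fun z => ENNReal.ofReal (gaussDensity z) * s.indicator 1 z)
      (measurable_gaussDensity.ennreal_ofReal.mul (measurable_one.indicator hs)), hn]
  simp only [one_pow, ENNReal.ofReal_one, one_mul, hdens]
  rfl

open scoped MatrixOrder ComplexOrder in
/-- The substitution `c = R^{1/2} u`, with the Hermitian square root, turns `cᴴ R⁻¹ c` into `|u|²`
and `|c|²` into `uᴴ R u`. -/
lemma gaussVec_quadForm_inv_le {R : Matrix κ κ ℂ} (hR : R.PosDef) (t : ℝ) :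
    gaussVec κ {c | (star c ⬝ᵥ (R⁻¹ *ᵥ c)).re ≤ t} =
      ∫⁻ u in {u : κ → ℂ | ∑ a, ‖u a‖ ^ 2 ≤ t}, ENNReal.ofReal
        ((Real.pi ^ Fintype.card κ)⁻¹ * (R.det.re * Real.exp (-(star u ⬝ᵥ (R *ᵥ u)).re))) := by
  set L : Matrix κ κ ℂ := CFC.sqrt R with hLdef
  have hLL : L * L = R := CFC.sqrt_mul_sqrt_self R hR.posSemidef.nonneg
  have hLH : Lᴴ = L := (Matrix.nonneg_iff_posSemidef.1 (CFC.sqrt_nonneg R)).isHermitian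
  have hdet : L.det * L.det = R.det := by rw [← Matrix.det_mul, hLL]
  have hL0 : L.det ≠ 0 := fun h => by
    rw [h, zero_mul] at hdet
    exact hR.det_pos.ne hdet
  have hLu : IsUnit L.det := isUnit_iff_ne_zero.2 hL0
  have hdetre : ‖L.det‖ ^ 2 = R.det.re := by
    have h : star L.det * L.det = R.det := by
      rw [← Matrix.det_conjTranspose, hLH, hdet]
    rw [← h, Complex.star_def, Complex.conj_mul', ← Complex.ofReal_pow, Complex.ofReal_re]
  have hinv : L * R⁻¹ * L = 1 := by
    rw [← hLL, Matrix.mul_inv_rev, ← mul_assoc, Matrix.mul_nonsing_inv _ hLu, one_mul,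
      Matrix.nonsing_inv_mul _ hLu]
  have hq : ∀ u, (star (L *ᵥ u) ⬝ᵥ (R⁻¹ *ᵥ (L *ᵥ u))).re = ∑ a, ‖u a‖ ^ 2 := by
    intro u
    rw [Matrix.star_mulVec, hLH, ← Matrix.dotProduct_mulVec, Matrix.mulVec_mulVec,
      Matrix.mulVec_mulVec, hinv, Matrix.one_mulVec, ← sum_norm_sq_eq,
      Complex.ofReal_re]
  have hn : ∀ u, ∑ a, ‖(L *ᵥ u) a‖ ^ 2 = (star u ⬝ᵥ (R *ᵥ u)).re := by
    intro u
    rw [← hLL]; nth_rewrite 2 [← hLH]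
    rw [← sum_norm_sq_mulVec, Complex.ofReal_re]
  have hs : MeasurableSet {c : κ → ℂ | (star c ⬝ᵥ (R⁻¹ *ᵥ c)).re ≤ t} := by
    refine measurableSet_le (Continuous.measurable ?_) measurable_const
    exact Complex.continuous_re.comp (Continuous.dotProduct continuous_star
      (Continuous.matrix_mulVec continuous_const continuous_id))
  have hs' : MeasurableSet {u : κ → ℂ | ∑ a, ‖u a‖ ^ 2 ≤ t} := by
    refine measurableSet_le (Continuous.measurable ?_) measurable_const
    fun_prop
  rw [← lintegral_indicator_one hs, lintegral_gaussVec (measurable_one.indicator hs),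
    lintegral_comp_mulVec hL0 (fun z => ENNReal.ofReal (gaussDensity z) *
        {c : κ → ℂ | (star c ⬝ᵥ (R⁻¹ *ᵥ c)).re ≤ t}.indicator 1 z)
      (measurable_gaussDensity.ennreal_ofReal.mul (measurable_one.indicator hs)),
    ← lintegral_const_mul' _ _ ENNReal.ofReal_ne_top, ← lintegral_indicator hs']
  refine lintegral_congr fun u => ?_
  by_cases hu : ∑ a, ‖u a‖ ^ 2 ≤ t
  · rw [Set.indicator_of_mem (by simpa only [Set.mem_ofPred_eq, hq] using hu),
      Set.indicator_of_mem (by simpa using hu), gaussDensity, hn, Pi.one_apply, mul_one,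
      ← ENNReal.ofReal_mul (by positivity), hdetre]
    congr 1; ring
  · rw [Set.indicator_of_notMem (by simpa only [Set.mem_ofPred_eq, hq] using hu),
      Set.indicator_of_notMem (by simpa using hu), mul_zero, mul_zero]

omit [DecidableEq κ] in
lemma volume_sum_norm_sq_le [Nonempty κ] {s : ℝ} (hs : 0 ≤ s) :
    volume {u : κ → ℂ | ∑ a, ‖u a‖ ^ 2 ≤ s} = ENNReal.ofReal
      (s ^ Fintype.card κ * (Real.pi ^ Fintype.card κ / (Fintype.card κ).factorial)) := by
  have h := Complex.volume_sum_rpow_le κ one_le_two (√s)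
  have hset : {u : κ → ℂ | (∑ a, ‖u a‖ ^ (2 : ℝ)) ^ (1 / (2 : ℝ)) ≤ √s} =
      {u : κ → ℂ | ∑ a, ‖u a‖ ^ 2 ≤ s} := by
    ext u
    simp only [Set.mem_ofPred_eq, ← Real.sqrt_eq_rpow, Real.rpow_two]
    exact Real.sqrt_le_sqrt_iff hs
  rw [hset] at h
  rw [h, ← ENNReal.ofReal_pow (Real.sqrt_nonneg _), ← ENNReal.ofReal_mul (by positivity), pow_mul,
    Real.sq_sqrt hs]
  congr 3
  · rw [div_self two_ne_zero, one_add_one_eq_two, Real.Gamma_two, mul_one]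
  · rw [mul_div_cancel_left₀ _ two_ne_zero, Real.Gamma_nat_eq_factorial]

omit [DecidableEq κ] in
/-- Lebesgue measure on `κ → ℂ` pushed forward by `u ↦ |u|²` has density
`π ^ K * r ^ (K - 1) / (K - 1)!` on `r > 0`, where `K` is the cardinality of `κ`. -/
lemma lintegral_sum_norm_sq [Nonempty κ] {f : ℝ → ENNReal} (hf : Measurable f) (t : ℝ) :
    ∫⁻ u in {u : κ → ℂ | ∑ a, ‖u a‖ ^ 2 ≤ t}, f (∑ a, ‖u a‖ ^ 2) =
      ∫⁻ r in Set.Ioc 0 t, ENNReal.ofReal (Real.pi ^ Fintype.card κ *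
        (r ^ (Fintype.card κ - 1) / (Fintype.card κ - 1).factorial)) * f r := by
  set K := Fintype.card κ with hK
  have hK0 : K ≠ 0 := Fintype.card_ne_zero
  let ρ : (κ → ℂ) → ℝ := fun u => ∑ a, ‖u a‖ ^ 2
  have hρ : Measurable ρ := Continuous.measurable (by fun_prop)
  let g : ℝ → ℝ := fun r => Real.pi ^ K * (r ^ (K - 1) / (K - 1).factorial)
  have hg : Continuous g := by fun_prop
  have hvol : ∀ m, volume {u : κ → ℂ | ρ u ≤ m} = ∫⁻ r in Set.Ioc 0 m, ENNReal.ofReal (g r) := by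
    intro m
    rcases lt_or_ge m 0 with hm | hm
    · rw [Set.Ioc_eq_empty (by linarith), Measure.restrict_empty, lintegral_zero_measure]
      have : {u : κ → ℂ | ρ u ≤ m} = ∅ := by
        ext u
        have : 0 ≤ ρ u := Finset.sum_nonneg fun a _ => by positivity
        simp only [Set.mem_ofPred_eq, Set.mem_empty_iff_false, iff_false, not_le]
        linarith
      rw [this, measure_empty]
    · have hint : ∫ r in (0 : ℝ)..m, g r = m ^ K * (Real.pi ^ K / K.factorial) := by
        simp only [g, intervalIntegral.integral_const_mul, intervalIntegral.integral_div,
          integral_pow, Nat.sub_add_cancel (Nat.one_le_iff_ne_zero.2 hK0), zero_pow hK0, sub_zero]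
        have hcast : ((K - 1 : ℕ) : ℝ) + 1 = K := by
          exact_mod_cast Nat.sub_add_cancel (Nat.one_le_iff_ne_zero.2 hK0)
        rw [← Nat.mul_factorial_pred hK0, hcast]
        push_cast
        have : (K : ℝ) ≠ 0 := by exact_mod_cast hK0
        field_simp
      rw [volume_sum_norm_sq_le hm, ← hK, ← hint, intervalIntegral.integral_of_le hm,
        ofReal_integral_eq_lintegral_ofReal (hg.integrableOn_Ioc)]
      refine (ae_restrict_iff' measurableSet_Ioc).2 (Filter.Eventually.of_forall fun r hr => ?_)
      have := hr.1
      simp only [Pi.zero_apply, g]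
      positivity
  -- After restriction to `ρ ≤ t` both measures are finite, hence determined by half-lines.
  let μ := (volume.restrict {u : κ → ℂ | ρ u ≤ t}).map ρ
  let ν := (volume.restrict (Set.Ioc 0 t)).withDensity fun r => ENNReal.ofReal (g r)
  have hμ : ∀ s, μ (Set.Iic s) = volume {u : κ → ℂ | ρ u ≤ min s t} := by
    intro s
    rw [Measure.map_apply hρ measurableSet_Iic, Measure.restrict_apply (hρ measurableSet_Iic)]
    congr 1
    ext u
    simp
  have hν : ∀ s, ν (Set.Iic s) = volume {u : κ → ℂ | ρ u ≤ min s t} := by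
    intro s
    rw [withDensity_apply _ measurableSet_Iic, Measure.restrict_restrict measurableSet_Iic, hvol,
      Set.inter_comm, Set.Ioc_inter_Iic, min_comm]
  have : IsFiniteMeasure μ := by
    refine ⟨?_⟩
    rw [Measure.map_apply hρ .univ, Set.preimage_univ, Measure.restrict_apply_univ]
    rcases lt_or_ge t 0 with ht | ht
    · rw [hvol, Set.Ioc_eq_empty (by linarith)]; simp
    · rw [volume_sum_norm_sq_le ht]; exact ENNReal.ofReal_lt_top
  have hμν : μ = ν := Measure.ext_of_Iic μ ν fun s => by rw [hμ, hν]
  calc _ = ∫⁻ r, f r ∂μ := (lintegral_map hf hρ).symm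
    _ = ∫⁻ r, f r ∂ν := by rw [hμν]
    _ = _ := lintegral_withDensity_eq_lintegral_mul _ (by fun_prop) hf

end GaussianVectors

/-! ### Gaussian moments with exponential weights -/

section GaussianMoments

lemma integral_complexGaussian (f : ℂ → ℂ) :
    ∫ z, f z ∂complexGaussian 1 = ∫ z, ((Real.pi⁻¹ * Real.exp (-‖z‖ ^ 2) : ℝ) : ℂ) * f z := by
  rw [complexGaussian_one_eq_withDensity, integral_withDensity_eq_integral_toReal_smul
    (by fun_prop) (Filter.Eventually.of_forall fun _ => ENNReal.ofReal_lt_top)]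
  refine integral_congr_ae (Filter.Eventually.of_forall fun z => ?_)
  simp only
  rw [ENNReal.toReal_ofReal (by positivity), Complex.real_smul]

lemma integral_pow_norm_mul_exp (k : ℕ) {s : ℝ} (hs : 0 ≤ s) :
    ∫ z, ((‖z‖ ^ (2 * k) * Real.exp (-(s * ‖z‖ ^ 2)) : ℝ) : ℂ) ∂complexGaussian 1 =
      (k.factorial * ((1 + s)⁻¹) ^ (k + 1) : ℝ) := by
  have hb : 0 < 1 + s := by linarith
  have h := Complex.integral_rpow_mul_exp_neg_mul_rpow (p := 2) (q := (2 * k : ℕ)) one_le_two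
    (lt_of_lt_of_le (by norm_num) (Nat.cast_nonneg _)) hb
  rw [integral_complexGaussian]
  simp_rw [← Complex.ofReal_mul]
  rw [integral_complex_ofReal]
  congr 1
  have e : ∀ z : ℂ, Real.pi⁻¹ * Real.exp (-‖z‖ ^ 2) * (‖z‖ ^ (2 * k) * Real.exp (-(s * ‖z‖ ^ 2))) =
      Real.pi⁻¹ * (‖z‖ ^ ((2 * k : ℕ) : ℝ) * Real.exp (-(1 + s) * ‖z‖ ^ (2 : ℝ))) := by
    intro z
    rw [Real.rpow_natCast, Real.rpow_two,
      show -(1 + s) * ‖z‖ ^ 2 = -‖z‖ ^ 2 + -(s * ‖z‖ ^ 2) by ring,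
      Real.exp_add]
    ring
  simp_rw [e]
  rw [integral_const_mul, h]
  have e1 : ((2 * k : ℕ) + 2 : ℝ) / 2 = k + 1 := by push_cast; ring
  have e2 : -((2 * k : ℕ) + 2 : ℝ) / 2 = -((k + 1 : ℕ) : ℝ) := by push_cast; ring
  rw [e1, e2, Real.Gamma_nat_eq_factorial, Real.rpow_neg hb.le, Real.rpow_natCast, inv_pow]
  field_simp

lemma integral_exp_complexGaussian {s : ℝ} (hs : 0 ≤ s) :
    ∫ z, (Real.exp (-(s * ‖z‖ ^ 2)) : ℂ) ∂complexGaussian 1 = ((1 + s)⁻¹ : ℝ) := by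
  simpa using integral_pow_norm_mul_exp 0 hs

lemma integral_exp_mul_self_mul_star_complexGaussian {s : ℝ} (hs : 0 ≤ s) :
    ∫ z, (Real.exp (-(s * ‖z‖ ^ 2)) : ℂ) * z * star z ∂complexGaussian 1 =
      (((1 + s)⁻¹) ^ 2 : ℝ) := by
  have h := integral_pow_norm_mul_exp 1 hs
  rw [Nat.factorial_one, Nat.cast_one, one_mul] at h
  rw [← h]
  refine integral_congr_ae (Filter.Eventually.of_forall fun z => ?_)
  simp only [mul_one, Complex.star_def]
  rw [mul_assoc, Complex.mul_conj', mul_comm]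
  push_cast
  rfl

/-- The weight is even, so odd functions integrate to `0`. -/
lemma integral_exp_mul_odd_complexGaussian (s : ℝ) {f : ℂ → ℂ} (hf : ∀ z, f (-z) = -f z) :
    ∫ z, (Real.exp (-(s * ‖z‖ ^ 2)) : ℂ) * f z ∂complexGaussian 1 = 0 := by
  rw [integral_complexGaussian, ← self_eq_neg, ← integral_neg]
  nth_rewrite 1 [← integral_neg_eq_self]
  simp [hf]

lemma integrable_norm_sq_complexGaussian : Integrable (fun z => ‖z‖ ^ 2) (complexGaussian 1) := by
  have h := integral_pow_norm_mul_exp 1 le_rfl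
  have hi : Integrable (fun z : ℂ => ((‖z‖ ^ 2 : ℝ) : ℂ)) (complexGaussian 1) := by
    -- A non-integrable function would have integral `0`.
    apply Integrable.of_integral_ne_zero
    simp only [mul_one, zero_mul, neg_zero, Real.exp_zero] at h
    rw [h]; simp
  exact hi.re

variable {κ : Type*} [Fintype κ] [DecidableEq κ]

omit [DecidableEq κ] in
lemma integral_prod_exp_gaussVec {s : κ → ℝ} (hs : ∀ c, 0 ≤ s c) :
    ∫ x, ∏ c, (Real.exp (-(s c * ‖x c‖ ^ 2)) : ℂ) ∂gaussVec κ = ((∏ c, (1 + s c)⁻¹ : ℝ) : ℂ) := by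
  rw [gaussVec, integral_fintype_prod_eq_prod (fun c z => (Real.exp (-(s c * ‖z‖ ^ 2)) : ℂ)),
    Complex.ofReal_prod]
  exact Finset.prod_congr rfl fun c _ => integral_exp_complexGaussian (hs c)

lemma integral_prod_exp_mul_mul_star_gaussVec {s : κ → ℝ} (hs : ∀ c, 0 ≤ s c) (a b : κ) :
    ∫ x, (∏ c, (Real.exp (-(s c * ‖x c‖ ^ 2)) : ℂ)) * x a * star (x b) ∂gaussVec κ =
      if a = b then (((∏ c, (1 + s c)⁻¹) * (1 + s a)⁻¹ : ℝ) : ℂ) else 0 := by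
  have e : ∀ x : κ → ℂ, (∏ c, (Real.exp (-(s c * ‖x c‖ ^ 2)) : ℂ)) * x a * star (x b) =
      ∏ c, ((Real.exp (-(s c * ‖x c‖ ^ 2)) : ℂ) * (if c = a then x c else 1) *
        (if c = b then star (x c) else 1)) := by
    intro x
    rw [Finset.prod_mul_distrib, Finset.prod_mul_distrib, Finset.prod_ite_eq' Finset.univ a,
      Finset.prod_ite_eq' Finset.univ b, if_pos (Finset.mem_univ _), if_pos (Finset.mem_univ _)]
  simp_rw [e]
  rw [gaussVec, integral_fintype_prod_eq_prod (fun c z => (Real.exp (-(s c * ‖z‖ ^ 2)) : ℂ) *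
    (if c = a then z else 1) * (if c = b then star z else 1))]
  split_ifs with hab
  · subst hab
    rw [← Finset.mul_prod_erase _ _ (Finset.mem_univ a),
      ← Finset.mul_prod_erase _ (fun c => (1 + s c)⁻¹) (Finset.mem_univ a)]
    simp only [if_true]
    rw [integral_exp_mul_self_mul_star_complexGaussian (hs a)]
    have : ∀ c ∈ Finset.univ.erase a, ∫ z, (Real.exp (-(s c * ‖z‖ ^ 2)) : ℂ) *
        (if c = a then z else 1) * (if c = a then star z else 1) ∂complexGaussian 1 =
        ((1 + s c)⁻¹ : ℝ) := by
      intro c hc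
      simp only [if_neg (Finset.ne_of_mem_erase hc), mul_one]
      exact integral_exp_complexGaussian (hs c)
    rw [Finset.prod_congr rfl this, ← Complex.ofReal_prod, ← Complex.ofReal_mul]
    congr 1
    ring
  · apply Finset.prod_eq_zero (Finset.mem_univ a)
    simp only [if_true, if_neg hab, mul_one]
    exact integral_exp_mul_odd_complexGaussian (s a) (f := id) fun _ => rfl

omit [DecidableEq κ] in
lemma integrable_mul_mul_star_gaussVec {w : (κ → ℂ) → ℂ} (hw : Measurable w)
    (hw1 : ∀ x, ‖w x‖ ≤ 1) (a b : κ) :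
    Integrable (fun x => w x * x a * star (x b)) (gaussVec κ) := by
  have hi : ∀ a, Integrable (fun x : κ → ℂ => ‖x a‖ ^ 2) (gaussVec κ) := fun a =>
    integrable_comp_eval (μ := fun _ : κ => complexGaussian 1) integrable_norm_sq_complexGaussian
  refine ((hi a).add (hi b)).mono' (Measurable.aestronglyMeasurable ?_)
    (Filter.Eventually.of_forall fun x => ?_)
  · exact (hw.mul (measurable_pi_apply a)).mul
      (continuous_star.measurable.comp (measurable_pi_apply b))
  · rw [norm_mul, norm_mul, norm_star, Pi.add_apply]
    have h1 : ‖w x‖ * ‖x a‖ * ‖x b‖ ≤ 1 * ‖x a‖ * ‖x b‖ := by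
      gcongr; exact hw1 x
    nlinarith [sq_nonneg (‖x a‖ - ‖x b‖), sq_nonneg (‖x a‖), sq_nonneg (‖x b‖)]

end GaussianMoments

/-! ### Determinants of rank-one perturbations -/

section RankOne

/-- The matrix determinant lemma in its polynomial form, valid for singular `B` as well. -/
lemma Matrix.det_add_vecMulVec_adjugate {m : Type*} [Fintype m] [DecidableEq m]
    (B : Matrix m m ℂ) (k l : m → ℂ) :
    (B + Matrix.vecMulVec k l).det = B.det + ∑ a, ∑ b, k a * l b * B.adjugate b a := by
  -- `z • 1 + B` is singular only at the finitely many roots of a characteristic polynomial, so the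
  -- identity for invertible matrices extends to `z = 0` by continuity.
  have hdens : Dense {z : ℂ | (z • (1 : Matrix m m ℂ) + B).det ≠ 0} := by
    have hfin : {z : ℂ | (z • (1 : Matrix m m ℂ) + B).det = 0}.Finite := by
      refine ((-B).charpoly.roots.toFinset.finite_toSet).subset fun z hz => ?_
      simp only [Finset.mem_coe, Multiset.mem_toFinset,
        Polynomial.mem_roots (-B).charpoly_monic.ne_zero, Polynomial.IsRoot, Matrix.eval_charpoly]
      rw [sub_neg_eq_add, Matrix.scalar_apply, ← Matrix.smul_one_eq_diagonal]
      exact hz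
    exact hfin.countable.dense_compl ℂ
  have hcont : Continuous fun z : ℂ => z • (1 : Matrix m m ℂ) + B := by fun_prop
  have key := Continuous.ext_on hdens
    (f := fun z : ℂ => ((z • (1 : Matrix m m ℂ) + B) + Matrix.vecMulVec k l).det)
    (g := fun z : ℂ => (z • (1 : Matrix m m ℂ) + B).det +
      ∑ a, ∑ b, k a * l b * (z • (1 : Matrix m m ℂ) + B).adjugate b a)
    (hcont.add continuous_const).matrix_det
    (hcont.matrix_det.add (continuous_finsetSum _ fun a _ => continuous_finsetSum _ fun b _ =>
      continuous_const.mul (hcont.matrix_adjugate.matrix_elem b a)))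
    (fun z hz => by
      have hu : IsUnit (z • (1 : Matrix m m ℂ) + B).det := isUnit_iff_ne_zero.2 hz
      simp only
      generalize z • (1 : Matrix m m ℂ) + B = A at hu
      rw [Matrix.vecMulVec_eq Unit, Matrix.det_add_replicateCol_mul_replicateRow hu,
        Matrix.det_unique (n := Unit), Matrix.inv_def, Ring.inverse_eq_inv']
      have h0 : A.det ≠ 0 := hu.ne_zero
      simp only [Matrix.add_apply, Matrix.one_apply_eq, Matrix.mul_apply, Matrix.replicateRow_apply,
        Matrix.replicateCol_apply, Matrix.smul_apply, smul_eq_mul, Finset.sum_mul, mul_add, mul_one,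
        Finset.mul_sum]
      congr 1
      refine Finset.sum_congr rfl fun a _ => Finset.sum_congr rfl fun b _ => ?_
      field_simp)
  simpa using congrFun key 0

end RankOne

/-! ### The expected determinant under exponential weights -/

section ExpectedDet

variable {ι κ : Type*} [Fintype κ] [DecidableEq κ]

/-- The exponential weight `exp (-s * |z a₀|²)` on a column, as a complex number. -/
def tiltWeight (a₀ : κ) (s : ℝ) (z : κ → ℂ) : ℂ := (Real.exp (-(s * ‖z a₀‖ ^ 2)) : ℂ)

omit [Fintype κ] [DecidableEq κ] in
lemma measurable_tiltWeight (a₀ : κ) (s : ℝ) : Measurable (tiltWeight a₀ s) := by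
  unfold tiltWeight; fun_prop

omit [Fintype κ] [DecidableEq κ] in
lemma norm_tiltWeight_le_one (a₀ : κ) {s : ℝ} (hs : 0 ≤ s) (z : κ → ℂ) :
    ‖tiltWeight a₀ s z‖ ≤ 1 := by
  rw [tiltWeight, Complex.norm_real, Real.norm_of_nonneg (Real.exp_pos _).le, Real.exp_le_one_iff]
  have := mul_nonneg hs (sq_nonneg ‖z a₀‖)
  linarith

lemma tiltWeight_eq_prod (a₀ : κ) (s : ℝ) (z : κ → ℂ) :
    tiltWeight a₀ s z =
      ∏ c, (Real.exp (-((Pi.single a₀ s : κ → ℝ) c * ‖z c‖ ^ 2)) : ℂ) := by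
  rw [Finset.prod_eq_single a₀ (fun c _ hc => by simp [Pi.single_eq_of_ne hc]) (by simp),
    Pi.single_eq_same, tiltWeight]

lemma prod_one_add_single_inv (a₀ : κ) (s : ℝ) :
    ∏ c, (1 + (Pi.single a₀ s : κ → ℝ) c)⁻¹ = (1 + s)⁻¹ := by
  rw [Finset.prod_eq_single a₀ (fun c _ hc => by simp [Pi.single_eq_of_ne hc]) (by simp),
    Pi.single_eq_same]

omit [Fintype κ] in
lemma single_apply_nonneg (a₀ : κ) {s : ℝ} (hs : 0 ≤ s) (c : κ) : 0 ≤ (Pi.single a₀ s : κ → ℝ) c :=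
  (Pi.single_nonneg.2 hs : (0 : κ → ℝ) ≤ Pi.single a₀ s) c

lemma integral_tiltWeight (a₀ : κ) {s : ℝ} (hs : 0 ≤ s) :
    ∫ z, tiltWeight a₀ s z ∂gaussVec κ = ((1 + s)⁻¹ : ℝ) := by
  simp_rw [tiltWeight_eq_prod]
  rw [integral_prod_exp_gaussVec (single_apply_nonneg a₀ hs), prod_one_add_single_inv]

lemma integral_tiltWeight_mul_mul_star (a₀ : κ) {s : ℝ} (hs : 0 ≤ s) (a b : κ) :
    ∫ z, tiltWeight a₀ s z * z a * star (z b) ∂gaussVec κ =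
      if a = b then (((1 + s)⁻¹ * if a = a₀ then (1 + s)⁻¹ else 1 : ℝ) : ℂ) else 0 := by
  simp_rw [tiltWeight_eq_prod]
  rw [integral_prod_exp_mul_mul_star_gaussVec (single_apply_nonneg a₀ hs), prod_one_add_single_inv]
  have : (1 + (Pi.single a₀ s : κ → ℝ) a)⁻¹ = if a = a₀ then (1 + s)⁻¹ else 1 := by
    split_ifs with h
    · rw [h, Pi.single_eq_same]
    · rw [Pi.single_eq_of_ne h]; simp
  rw [this]

/-- The matrix `N0 I + ∑ n ∈ S, β n • x_n x_nᴴ`, where the family `x` lists the columns of the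
channel matrix. -/
def noisyCov (β : ι → ℝ) (N0 : ℝ) (S : Finset ι) (x : ι → κ → ℂ) : Matrix κ κ ℂ :=
  (N0 : ℂ) • 1 + ∑ n ∈ S, (β n : ℂ) • Matrix.vecMulVec (x n) (star (x n))

omit [Fintype κ] in
lemma continuous_noisyCov (β : ι → ℝ) (N0 : ℝ) (S : Finset ι) :
    Continuous (noisyCov (κ := κ) β N0 S) := by
  refine continuous_const.add (continuous_finsetSum _ fun n _ => ?_)
  have h : Continuous fun x : ι → κ → ℂ => x n := continuous_apply n
  exact (h.matrix_vecMulVec h.star).const_smul (β n : ℂ)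

/-- The minor of `noisyCov β N0 S x` with rows `f` and columns `g`, multiplied by the exponential
weights of all columns in `S`. Minors indexed by arbitrary maps are stable under the Laplace
expansion. -/
def tiltedMinor (β : ι → ℝ) (N0 r : ℝ) (a₀ : κ) (S : Finset ι) {m : ℕ} (f g : Fin m → κ)
    (x : ι → κ → ℂ) : ℂ :=
  (∏ n ∈ S, tiltWeight a₀ (β n * r) (x n)) * ((noisyCov β N0 S x).submatrix f g).det

lemma measurable_tiltedMinor [Countable ι] (β : ι → ℝ) (N0 r : ℝ) (a₀ : κ) (S : Finset ι) {m : ℕ}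
    (f g : Fin m → κ) : Measurable (tiltedMinor β N0 r a₀ S f g) := by
  refine Measurable.mul (Finset.measurable_fun_prod _ fun n _ =>
    (measurable_tiltWeight a₀ _).comp (measurable_pi_apply n)) ?_
  have h : Continuous fun x : ι → κ → ℂ => ((noisyCov β N0 S x).submatrix f g).det :=
    ((continuous_noisyCov β N0 S).matrix_submatrix f g).matrix_det
  exact h.measurable

omit [Fintype κ] in
lemma tiltedMinor_congr (β : ι → ℝ) (N0 r : ℝ) (a₀ : κ) (S : Finset ι) {m : ℕ} (f g : Fin m → κ)
    {x y : ι → κ → ℂ} (h : ∀ n ∈ S, x n = y n) :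
    tiltedMinor β N0 r a₀ S f g x = tiltedMinor β N0 r a₀ S f g y := by
  have h1 : noisyCov β N0 S x = noisyCov β N0 S y := by
    unfold noisyCov
    congr 1
    exact Finset.sum_congr rfl fun n hn => by rw [h n hn]
  rw [tiltedMinor, tiltedMinor, h1, Finset.prod_congr rfl fun n hn => by rw [h n hn]]

omit [Fintype κ] in
lemma noisyCov_insert [DecidableEq ι] (β : ι → ℝ) (N0 : ℝ) {S : Finset ι} {n : ι} (hn : n ∉ S)
    (x : ι → κ → ℂ) : noisyCov β N0 (insert n S) x =
      noisyCov β N0 S x + (β n : ℂ) • Matrix.vecMulVec (x n) (star (x n)) := by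
  rw [noisyCov, noisyCov, Finset.sum_insert hn]
  abel

omit [Fintype κ] in
lemma tiltedMinor_zero (β : ι → ℝ) (N0 r : ℝ) (a₀ : κ) (S : Finset ι) (f g : Fin 0 → κ)
    (x : ι → κ → ℂ) :
    tiltedMinor β N0 r a₀ S f g x = ∏ n ∈ S, tiltWeight a₀ (β n * r) (x n) := by
  simp [tiltedMinor]

omit [Fintype κ] in
lemma tiltedMinor_insert_zero [DecidableEq ι] (β : ι → ℝ) (N0 r : ℝ) (a₀ : κ) {S : Finset ι} {n : ι}
    (hn : n ∉ S) (f g : Fin 0 → κ) (x : ι → κ → ℂ) :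
    tiltedMinor β N0 r a₀ (insert n S) f g x =
      tiltedMinor β N0 r a₀ S f g x * tiltWeight a₀ (β n * r) (x n) := by
  rw [tiltedMinor_zero, tiltedMinor_zero, Finset.prod_insert hn, mul_comm]

omit [Fintype κ] in
/-- The determinant lemma for an additional column, with the adjugate written as signed minors. -/
lemma tiltedMinor_insert_succ [DecidableEq ι] (β : ι → ℝ) (N0 r : ℝ) (a₀ : κ) {S : Finset ι} {n : ι}
    (hn : n ∉ S) {m : ℕ} (f g : Fin (m + 1) → κ) (x : ι → κ → ℂ) :
    tiltedMinor β N0 r a₀ (insert n S) f g x =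
      tiltedMinor β N0 r a₀ S f g x * tiltWeight a₀ (β n * r) (x n) +
      ∑ a : Fin (m + 1), ∑ b : Fin (m + 1), (β n * (-1) ^ (a + b : ℕ) : ℂ) *
        (tiltedMinor β N0 r a₀ S (f ∘ a.succAbove) (g ∘ b.succAbove) x *
          (tiltWeight a₀ (β n * r) (x n) * x n (f a) * star (x n (g b)))) := by
  have hsub : (noisyCov β N0 (insert n S) x).submatrix f g = (noisyCov β N0 S x).submatrix f g +
      Matrix.vecMulVec (fun a => (β n : ℂ) * x n (f a)) (fun b => star (x n (g b))) := by
    rw [noisyCov_insert β N0 hn]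
    ext a b
    simp [Matrix.vecMulVec_apply, mul_assoc]
  rw [tiltedMinor, hsub, Matrix.det_add_vecMulVec_adjugate, Finset.prod_insert hn, mul_add]
  congr 1
  · rw [tiltedMinor]; ring
  · rw [Finset.mul_sum]
    refine Finset.sum_congr rfl fun a _ => ?_
    rw [Finset.mul_sum]
    refine Finset.sum_congr rfl fun b _ => ?_
    rw [Matrix.adjugate_fin_succ_eq_det_submatrix, tiltedMinor, Matrix.submatrix_submatrix]
    ring

variable [Fintype ι] [DecidableEq ι]

omit [Fintype ι] [Fintype κ] [DecidableEq κ] in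
lemma measurable_piecewise_zero (S : Finset ι) :
    Measurable fun (x : ι → κ → ℂ) j => if j ∈ S then x j else 0 := by
  refine measurable_pi_lambda _ fun j => ?_
  by_cases hj : j ∈ S
  · simpa only [hj, if_true] using measurable_pi_apply j
  · simpa only [hj, if_false] using measurable_const

omit [DecidableEq κ] in
lemma indepFun_piecewise_eval {S : Finset ι} {n : ι} (hn : n ∉ S) :
    IndepFun (fun (x : ι → κ → ℂ) j => if j ∈ S then x j else 0) (fun x => x n)
      (Measure.pi fun _ : ι => gaussVec κ) := by
  have hX : iIndepFun (fun (j : ι) (x : ι → κ → ℂ) => x j) (Measure.pi fun _ : ι => gaussVec κ) :=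
    iIndepFun_pi (X := fun _ => id) fun _ => aemeasurable_id
  have h := hX.indepFun_finset S {n} (by simpa using hn) fun j => measurable_pi_apply j
  let ext : (S → κ → ℂ) → ι → κ → ℂ := fun y j => if h : j ∈ S then y ⟨j, h⟩ else 0
  have hext : Measurable ext := by
    refine measurable_pi_lambda _ fun j => ?_
    by_cases hj : j ∈ S
    · simpa only [ext, hj, dif_pos] using measurable_pi_apply _
    · simpa only [ext, hj, dif_neg, not_false_eq_true] using measurable_const
  exact h.comp hext (measurable_pi_apply (⟨n, Finset.mem_singleton_self n⟩ : ({n} : Finset ι)))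

omit [DecidableEq κ] in
/-- A function of the columns in `S` is independent of any other column. -/
lemma indepFun_of_notMem {S : Finset ι} {n : ι} (hn : n ∉ S) {G : (ι → κ → ℂ) → ℂ}
    (hG : Measurable G) (hGS : ∀ x y, (∀ k ∈ S, x k = y k) → G x = G y)
    {H : (κ → ℂ) → ℂ} (hH : Measurable H) :
    IndepFun G (fun x => H (x n)) (Measure.pi fun _ : ι => gaussVec κ) := by
  have e : G = G ∘ fun (x : ι → κ → ℂ) j => if j ∈ S then x j else 0 := by
    funext x
    exact hGS _ _ fun k hk => by simp [hk]
  rw [e]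
  exact (indepFun_piecewise_eval hn).comp hG hH

variable {β : ι → ℝ} (N0 : ℝ) {r : ℝ} (a₀ : κ) {S : Finset ι} {n : ι} {m : ℕ}

omit [DecidableEq ι] [DecidableEq κ] in
lemma integrable_comp_eval_gaussVec {H : (κ → ℂ) → ℂ} (hH : Integrable H (gaussVec κ)) (n : ι) :
    Integrable (fun x : ι → κ → ℂ => H (x n)) (Measure.pi fun _ : ι => gaussVec κ) :=
  integrable_comp_eval (μ := fun _ : ι => gaussVec κ) hH

lemma integrable_tiltedMinor_mul {H : (κ → ℂ) → ℂ} (hHm : Measurable H)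
    (hH : Integrable H (gaussVec κ)) (hn : n ∉ S) {f g : Fin m → κ}
    (hi : Integrable (tiltedMinor β N0 r a₀ S f g) (Measure.pi fun _ : ι => gaussVec κ)) :
    Integrable (fun x => tiltedMinor β N0 r a₀ S f g x * H (x n))
      (Measure.pi fun _ : ι => gaussVec κ) :=
  (indepFun_of_notMem hn (measurable_tiltedMinor β N0 r a₀ S f g)
    (fun _ _ h => tiltedMinor_congr β N0 r a₀ S f g h) hHm).integrable_mul hi
    (integrable_comp_eval_gaussVec hH n)

lemma integral_tiltedMinor_mul {H : (κ → ℂ) → ℂ} (hHm : Measurable H) (hn : n ∉ S)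
    (f g : Fin m → κ) :
    ∫ x, tiltedMinor β N0 r a₀ S f g x * H (x n) ∂(Measure.pi fun _ : ι => gaussVec κ) =
      (∫ x, tiltedMinor β N0 r a₀ S f g x ∂(Measure.pi fun _ : ι => gaussVec κ)) *
        ∫ z, H z ∂gaussVec κ := by
  have hm := measurable_tiltedMinor β N0 r a₀ S f g
  rw [(indepFun_of_notMem hn hm (fun _ _ h => tiltedMinor_congr β N0 r a₀ S f g h)
    hHm).integral_fun_mul_eq_mul_integral hm.aestronglyMeasurable
    (hHm.comp (measurable_pi_apply n)).aestronglyMeasurable]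
  congr 1
  exact integral_comp_eval (μ := fun _ : ι => gaussVec κ) hHm.aestronglyMeasurable

omit [DecidableEq κ] in
lemma integrable_tiltWeight {s : ℝ} (hs : 0 ≤ s) : Integrable (tiltWeight a₀ s) (gaussVec κ) :=
  Integrable.of_bound (measurable_tiltWeight a₀ s).aestronglyMeasurable 1
    (Filter.Eventually.of_forall (norm_tiltWeight_le_one a₀ hs))

omit [Fintype κ] [DecidableEq κ] in
lemma measurable_tiltWeight_mul_mul_star (s : ℝ) (a b : κ) :
    Measurable fun z : κ → ℂ => tiltWeight a₀ s z * z a * star (z b) :=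
  ((measurable_tiltWeight a₀ _).mul (measurable_pi_apply a)).mul
    (continuous_star.measurable.comp (measurable_pi_apply b))

omit [DecidableEq κ] in
lemma integrable_tiltWeight_mul_mul_star {s : ℝ} (hs : 0 ≤ s) (a b : κ) :
    Integrable (fun z : κ → ℂ => tiltWeight a₀ s z * z a * star (z b)) (gaussVec κ) :=
  integrable_mul_mul_star_gaussVec (measurable_tiltWeight a₀ _) (norm_tiltWeight_le_one a₀ hs) a b

lemma integrable_tiltedMinor (hβ : ∀ n, 0 ≤ β n) (hr : 0 ≤ r) (S : Finset ι) (f g : Fin m → κ) :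
    Integrable (tiltedMinor β N0 r a₀ S f g) (Measure.pi fun _ : ι => gaussVec κ) := by
  induction S using Finset.induction_on generalizing m with
  | empty =>
    have : tiltedMinor β N0 r a₀ ∅ f g = fun _ : ι → κ → ℂ => tiltedMinor β N0 r a₀ ∅ f g 0 := by
      funext x
      exact tiltedMinor_congr β N0 r a₀ ∅ f g (by simp)
    rw [this]
    exact integrable_const _
  | insert n S hn ih =>
    have hs : 0 ≤ β n * r := mul_nonneg (hβ n) hr
    have h0 := integrable_tiltedMinor_mul N0 a₀ (measurable_tiltWeight a₀ _)
      (integrable_tiltWeight a₀ hs) hn (ih f g)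
    cases m with
    | zero => exact h0.congr (Filter.Eventually.of_forall fun x =>
        (tiltedMinor_insert_zero β N0 r a₀ hn f g x).symm)
    | succ m =>
      have hsum := h0.add (integrable_finsetSum Finset.univ fun (a : Fin (m + 1)) _ =>
        integrable_finsetSum Finset.univ fun (b : Fin (m + 1)) _ =>
        (integrable_tiltedMinor_mul N0 a₀ (measurable_tiltWeight_mul_mul_star a₀ _ (f a) (g b))
          (integrable_tiltWeight_mul_mul_star a₀ hs (f a) (g b)) hn
          (ih (f ∘ a.succAbove) (g ∘ b.succAbove))).const_mul (β n * (-1) ^ (a + b : ℕ) : ℂ))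
      exact hsum.congr (Filter.Eventually.of_forall fun x =>
        (tiltedMinor_insert_succ β N0 r a₀ hn f g x).symm)

lemma integral_tiltedMinor_insert_zero (hβ : ∀ n, 0 ≤ β n) (hr : 0 ≤ r) (hn : n ∉ S)
    (f : Fin 0 → κ) :
    ∫ x, tiltedMinor β N0 r a₀ (insert n S) f f x ∂(Measure.pi fun _ : ι => gaussVec κ) =
      ((1 + β n * r)⁻¹ : ℝ) *
        ∫ x, tiltedMinor β N0 r a₀ S f f x ∂(Measure.pi fun _ : ι => gaussVec κ) := by
  simp_rw [tiltedMinor_insert_zero β N0 r a₀ hn f f]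
  rw [integral_tiltedMinor_mul N0 a₀ (measurable_tiltWeight a₀ _) hn,
    integral_tiltWeight a₀ (mul_nonneg (hβ n) hr), mul_comm]

/-- Off-diagonal second moments of the weighted additional column vanish, so only principal minors
remain. -/
lemma integral_tiltedMinor_insert_succ (hβ : ∀ n, 0 ≤ β n) (hr : 0 ≤ r) (hn : n ∉ S)
    {f : Fin (m + 1) → κ} (hf : Function.Injective f) :
    ∫ x, tiltedMinor β N0 r a₀ (insert n S) f f x ∂(Measure.pi fun _ : ι => gaussVec κ) =
      ((1 + β n * r)⁻¹ : ℝ) *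
        (∫ x, tiltedMinor β N0 r a₀ S f f x ∂(Measure.pi fun _ : ι => gaussVec κ) +
        ∑ a, ((β n * if f a = a₀ then (1 + β n * r)⁻¹ else 1 : ℝ) : ℂ) *
          ∫ x, tiltedMinor β N0 r a₀ S (f ∘ a.succAbove) (f ∘ a.succAbove) x
            ∂(Measure.pi fun _ : ι => gaussVec κ)) := by
  have hs : 0 ≤ β n * r := mul_nonneg (hβ n) hr
  have hi : ∀ a b : Fin (m + 1), Integrable (fun x => (β n * (-1) ^ (a + b : ℕ) : ℂ) *
        (tiltedMinor β N0 r a₀ S (f ∘ a.succAbove) (f ∘ b.succAbove) x *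
          (tiltWeight a₀ (β n * r) (x n) * x n (f a) * star (x n (f b)))))
        (Measure.pi fun _ : ι => gaussVec κ) := fun a b =>
    (integrable_tiltedMinor_mul N0 a₀ (measurable_tiltWeight_mul_mul_star a₀ _ (f a) (f b))
      (integrable_tiltWeight_mul_mul_star a₀ hs (f a) (f b)) hn
      (integrable_tiltedMinor N0 a₀ hβ hr S _ _)).const_mul _
  simp_rw [tiltedMinor_insert_succ β N0 r a₀ hn f f]
  rw [integral_add (integrable_tiltedMinor_mul N0 a₀ (measurable_tiltWeight a₀ _)
      (integrable_tiltWeight a₀ hs) hn (integrable_tiltedMinor N0 a₀ hβ hr S f f))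
      (integrable_finsetSum _ fun a _ => integrable_finsetSum _ fun b _ => hi a b),
    integral_tiltedMinor_mul N0 a₀ (measurable_tiltWeight a₀ _) hn, integral_tiltWeight a₀ hs,
    mul_add, mul_comm, integral_finsetSum _ fun a _ => integrable_finsetSum _ fun b _ => hi a b,
    Finset.mul_sum]
  congr 1
  refine Finset.sum_congr rfl fun a _ => ?_
  rw [integral_finsetSum _ fun b _ => hi a b, Finset.sum_eq_single a]
  · rw [integral_const_mul, integral_tiltedMinor_mul N0 a₀
      (measurable_tiltWeight_mul_mul_star a₀ _ (f a) (f a)) hn,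
      integral_tiltWeight_mul_mul_star a₀ hs, if_pos rfl, Even.neg_one_pow ⟨_, rfl⟩]
    push_cast
    ring
  · intro b _ hb
    rw [integral_const_mul, integral_tiltedMinor_mul N0 a₀
      (measurable_tiltWeight_mul_mul_star a₀ _ (f a) (f b)) hn,
      integral_tiltWeight_mul_mul_star a₀ hs, if_neg fun h => hb (hf h).symm, mul_zero, mul_zero]
  · simp

omit [DecidableEq ι] in
lemma integral_tiltedMinor_empty (f : Fin m → κ) (hf : Function.Injective f) :
    ∫ x, tiltedMinor β N0 r a₀ ∅ f f x ∂(Measure.pi fun _ : ι => gaussVec κ) =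
      (N0 ^ m : ℝ) := by
  have : ∀ x : ι → κ → ℂ, tiltedMinor β N0 r a₀ ∅ f f x = (N0 ^ m : ℝ) := by
    intro x
    have : (noisyCov β N0 ∅ x).submatrix f f = (N0 : ℂ) • (1 : Matrix (Fin m) (Fin m) ℂ) := by
      rw [noisyCov, Finset.sum_empty, add_zero, ← Matrix.submatrix_one f hf]
      rfl
    rw [tiltedMinor, this, Finset.prod_empty, one_mul, Matrix.det_smul]
    simp
  simp [this]

/-- A principal minor avoiding the row `a₀` sees the weights only through their expectations. -/
lemma integral_tiltedMinor_of_notMem_range (hβ : ∀ n, 0 ≤ β n) (hr : 0 ≤ r) (S : Finset ι)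
    {f : Fin m → κ} (hf : Function.Injective f) (h0 : ∀ a, f a ≠ a₀) :
    ∫ x, tiltedMinor β N0 r a₀ S f f x ∂(Measure.pi fun _ : ι => gaussVec κ) =
      (((∏ n ∈ S, (1 + β n * r)⁻¹) * (m.factorial * genCoeff β N0 S m) : ℝ) : ℂ) := by
  induction S using Finset.induction_on generalizing m with
  | empty =>
    rw [integral_tiltedMinor_empty N0 a₀ f hf, genCoeff_empty]
    congr 1
    have : (m.factorial : ℝ) ≠ 0 := by positivity
    simp; field_simp
  | insert n S hn ih =>
    rw [Finset.prod_insert hn]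
    cases m with
    | zero =>
      rw [integral_tiltedMinor_insert_zero N0 a₀ hβ hr hn, ih hf h0]
      push_cast
      simp
    | succ m =>
      rw [integral_tiltedMinor_insert_succ N0 a₀ hβ hr hn hf, ih hf h0]
      have : ∀ a : Fin (m + 1), _ := fun a => ih (f := f ∘ a.succAbove)
        (hf.comp Fin.succAbove_right_injective) fun b => h0 _
      simp only [this, h0, if_false, mul_one, Finset.sum_const, Finset.card_univ, Fintype.card_fin,
        genCoeff_insert_succ β N0 hn, Nat.factorial_succ]
      push_cast
      simp
      ring

/-- In a principal minor containing the row `a₀`, the entries of that row have variance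
`(1 + β n * r)⁻¹` under the weights. -/
lemma integral_tiltedMinor_of_mem_range (hβ : ∀ n, 0 ≤ β n) (hr : 0 ≤ r) (S : Finset ι)
    {f : Fin (m + 1) → κ} (hf : Function.Injective f) {a : Fin (m + 1)} (ha : f a = a₀) :
    ∫ x, tiltedMinor β N0 r a₀ S f f x ∂(Measure.pi fun _ : ι => gaussVec κ) =
      (((∏ n ∈ S, (1 + β n * r)⁻¹) * (m.factorial * tiltCoeff β N0 r S m) : ℝ) : ℂ) := by
  induction S using Finset.induction_on generalizing m with
  | empty =>
    rw [integral_tiltedMinor_empty N0 a₀ f hf, tiltCoeff_empty]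
    congr 1
    have : (m.factorial : ℝ) ≠ 0 := by positivity
    simp; field_simp
  | insert n S hn ih =>
    have hother : ∀ b, b ≠ a → f b ≠ a₀ := fun b hb h => hb (hf (h.trans ha.symm))
    rw [Finset.prod_insert hn, integral_tiltedMinor_insert_succ N0 a₀ hβ hr hn hf, ih hf ha,
      ← Finset.add_sum_erase _ _ (Finset.mem_univ a), if_pos ha,
      integral_tiltedMinor_of_notMem_range N0 a₀ hβ hr S
        (hf.comp Fin.succAbove_right_injective) fun b => hother _ (Fin.succAbove_ne a b)]
    cases m with
    | zero =>
      have : (Finset.univ.erase a : Finset (Fin 1)) = ∅ := by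
        ext b; simp [Subsingleton.elim b a]
      rw [this, tiltCoeff_insert_zero β N0 r hn]
      push_cast
      simp
      ring
    | succ m =>
      have : ∀ b ∈ Finset.univ.erase a,
          ((β n * if f b = a₀ then (1 + β n * r)⁻¹ else 1 : ℝ) : ℂ) *
            ∫ x, tiltedMinor β N0 r a₀ S (f ∘ b.succAbove) (f ∘ b.succAbove) x
              ∂(Measure.pi fun _ : ι => gaussVec κ) =
          ((β n * ((∏ n ∈ S, (1 + β n * r)⁻¹) *
            (m.factorial * tiltCoeff β N0 r S m)) : ℝ) : ℂ) := by
        intro b hb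
        have hba := Finset.ne_of_mem_erase hb
        obtain ⟨c, hc⟩ := Fin.exists_succAbove_eq hba.symm
        rw [if_neg (hother b hba), mul_one, ih (f := f ∘ b.succAbove)
          (hf.comp Fin.succAbove_right_injective) (a := c) (by simp [hc, ha]), ← Complex.ofReal_mul]
      rw [Finset.sum_congr rfl this, Finset.sum_const, Finset.card_erase_of_mem (Finset.mem_univ a),
        Finset.card_univ, Fintype.card_fin, tiltCoeff_insert_succ β N0 r hn, Nat.factorial_succ]
      push_cast
      simp
      ring

end ExpectedDet

/-! ### Rotating the direction of the exponential weight -/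

section Rotation

variable {ι κ : Type*} [Fintype κ] [DecidableEq κ]

lemma exists_unitary_mulVec_eq_single (a₀ : κ) (u : κ → ℂ) :
    ∃ U ∈ Matrix.unitaryGroup κ ℂ, U *ᵥ u = Pi.single a₀ (√(∑ a, ‖u a‖ ^ 2) : ℂ) := by
  set v : EuclideanSpace ℂ κ := WithLp.toLp 2 u with hv
  have hnorm : ‖v‖ = √(∑ a, ‖u a‖ ^ 2) := EuclideanSpace.norm_eq v
  rw [← hnorm]
  by_cases h0 : v = 0
  · refine ⟨1, one_mem _, ?_⟩
    have : u = 0 := by simpa [hv] using h0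
    simp [h0, this]
  · have hn0 : (‖v‖ : ℂ) ≠ 0 := by simpa using h0
    have ho : Orthonormal ℂ (({a₀} : Set κ).domRestrict fun _ => (‖v‖ : ℂ)⁻¹ • v) := by
      refine ⟨fun i => ?_, fun i j hij => absurd (Subsingleton.elim i j) hij⟩
      change ‖(‖v‖ : ℂ)⁻¹ • v‖ = 1
      rw [norm_smul, norm_inv, Complex.norm_real, norm_norm]
      exact inv_mul_cancel₀ (by simpa using h0)
    obtain ⟨b, hb⟩ := ho.exists_orthonormalBasis_extension_of_card_eq (by simp)
    have hb0 : b a₀ = (‖v‖ : ℂ)⁻¹ • v := hb a₀ rfl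
    refine ⟨b.toBasis.toMatrix (EuclideanSpace.basisFun κ ℂ), ?_, ?_⟩
    · exact b.toMatrix_orthonormalBasis_mem_unitary (EuclideanSpace.basisFun κ ℂ)
    · have hu : u = (EuclideanSpace.basisFun κ ℂ).toBasis.repr v := by
        funext a; simp [hv]
      rw [hu]
      have h := Module.Basis.toMatrix_mulVec_repr (EuclideanSpace.basisFun κ ℂ).toBasis b.toBasis v
      simp only [OrthonormalBasis.coe_toBasis] at h
      rw [h]
      funext a
      have hv' : v = (‖v‖ : ℂ) • b a₀ := by rw [hb0, smul_smul, mul_inv_cancel₀ hn0, one_smul]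
      rw [OrthonormalBasis.coe_toBasis_repr_apply]
      nth_rewrite 1 [hv']
      rw [map_smul, b.repr_self]
      simp [Pi.single_apply]

lemma noisyCov_mulVec (β : ι → ℝ) (N0 : ℝ) (S : Finset ι) {U : Matrix κ κ ℂ}
    (hU : U ∈ Matrix.unitaryGroup κ ℂ) (x : ι → κ → ℂ) :
    noisyCov β N0 S (fun n => U *ᵥ x n) = U * noisyCov β N0 S x * Uᴴ := by
  have hUU : U * Uᴴ = 1 := Matrix.mem_unitaryGroup_iff.1 hU
  simp only [noisyCov, mul_add, add_mul, Finset.mul_sum, Finset.sum_mul, Matrix.mul_smul,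
    Matrix.smul_mul, mul_one, hUU]
  congr 1
  refine Finset.sum_congr rfl fun n _ => ?_
  rw [Matrix.mul_vecMulVec, Matrix.vecMulVec_mul, Matrix.star_mulVec]

/-- The integrand `det B * exp (-uᴴ B u)` for `B = noisyCov β N0 S x`, as a complex number. -/
def detExp (β : ι → ℝ) (N0 : ℝ) (S : Finset ι) (u : κ → ℂ) (x : ι → κ → ℂ) : ℂ :=
  (noisyCov β N0 S x).det * (Real.exp (-(star u ⬝ᵥ (noisyCov β N0 S x *ᵥ u)).re) : ℂ)

/-- Rotating `u` and all columns by the same unitary matrix changes nothing. -/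
lemma detExp_mulVec (β : ι → ℝ) (N0 : ℝ) (S : Finset ι) {U : Matrix κ κ ℂ}
    (hU : U ∈ Matrix.unitaryGroup κ ℂ) (u : κ → ℂ) (x : ι → κ → ℂ) :
    detExp β N0 S (U *ᵥ u) (fun n => U *ᵥ x n) = detExp β N0 S u x := by
  have hUU : Uᴴ * U = 1 := Matrix.mem_unitaryGroup_iff'.1 hU
  have hdet : (U * noisyCov β N0 S x * Uᴴ).det = (noisyCov β N0 S x).det := by
    have hUU' : U * Uᴴ = 1 := Matrix.mem_unitaryGroup_iff.1 hU
    rw [Matrix.det_mul, Matrix.det_mul, mul_right_comm, ← Matrix.det_mul, hUU',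
      Matrix.det_one, one_mul]
  rw [detExp, detExp, noisyCov_mulVec β N0 S hU, hdet]
  congr 4
  rw [Matrix.star_mulVec, ← Matrix.dotProduct_mulVec, Matrix.mulVec_mulVec, Matrix.mulVec_mulVec]
  congr 2
  rw [mul_assoc, mul_assoc, hUU, mul_one, ← mul_assoc, hUU, one_mul]

lemma detExp_single {m : ℕ} (β : ι → ℝ) (N0 : ℝ) (S : Finset ι) {r : ℝ} (hr : 0 ≤ r)
    (x : ι → Fin (m + 1) → ℂ) :
    detExp β N0 S (Pi.single 0 (√r : ℂ)) x =
      (Real.exp (-(N0 * r)) : ℂ) * tiltedMinor β N0 r 0 S id id x := by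
  have hq : (star (Pi.single 0 (√r : ℂ) : Fin (m + 1) → ℂ) ⬝ᵥ
      (noisyCov β N0 S x *ᵥ Pi.single 0 (√r : ℂ))).re =
      N0 * r + ∑ n ∈ S, β n * r * ‖x n 0‖ ^ 2 := by
    have h1 : star (Pi.single 0 (√r : ℂ) : Fin (m + 1) → ℂ) ⬝ᵥ
      (noisyCov β N0 S x *ᵥ Pi.single 0 (√r : ℂ)) = (r : ℂ) * noisyCov β N0 S x 0 0 := by
      rw [Pi.star_single, single_dotProduct, Matrix.mulVec_single]
      simp only [Complex.star_def, Complex.conj_ofReal, Pi.smul_apply, Matrix.col_apply,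
        MulOpposite.smul_eq_mul_unop, MulOpposite.unop_op]
      rw [mul_left_comm, ← Complex.ofReal_mul, Real.mul_self_sqrt hr, mul_comm]
    have h2 : noisyCov β N0 S x 0 0 = ((N0 + ∑ n ∈ S, β n * ‖x n 0‖ ^ 2 : ℝ) : ℂ) := by
      rw [noisyCov, Matrix.add_apply, Matrix.sum_apply]
      simp [Matrix.vecMulVec_apply, Complex.mul_conj']
    rw [h1, h2, ← Complex.ofReal_mul, Complex.ofReal_re, mul_add, Finset.mul_sum, mul_comm r]
    congr 1
    exact Finset.sum_congr rfl fun n _ => by ring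
  rw [detExp, hq, tiltedMinor, Matrix.submatrix_id_id, neg_add, Real.exp_add,
    ← Finset.sum_neg_distrib, Real.exp_sum]
  simp only [tiltWeight]
  push_cast
  ring

variable [Fintype ι] [DecidableEq ι]

lemma integrable_and_integral_detExp {m : ℕ} {β : ι → ℝ} (hβ : ∀ n, 0 ≤ β n) (N0 : ℝ)
    (S : Finset ι) (u : Fin (m + 1) → ℂ) :
    Integrable (detExp β N0 S u) (Measure.pi fun _ : ι => gaussVec (Fin (m + 1))) ∧
    ∫ x, detExp β N0 S u x ∂(Measure.pi fun _ : ι => gaussVec (Fin (m + 1))) =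
      ((Real.exp (-(N0 * ∑ a, ‖u a‖ ^ 2)) * ((∏ n ∈ S, (1 + β n * ∑ a, ‖u a‖ ^ 2)⁻¹) *
        (m.factorial * tiltCoeff β N0 (∑ a, ‖u a‖ ^ 2) S m)) : ℝ) : ℂ) := by
  have hr : 0 ≤ ∑ a, ‖u a‖ ^ 2 := Finset.sum_nonneg fun a _ => by positivity
  obtain ⟨U, hU, hUu⟩ := exists_unitary_mulVec_eq_single 0 u
  generalize ∑ a, ‖u a‖ ^ 2 = r at *
  have hmp : MeasurePreserving (fun (x : ι → Fin (m + 1) → ℂ) n => U *ᵥ x n)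
      (Measure.pi fun _ : ι => gaussVec (Fin (m + 1)))
      (Measure.pi fun _ : ι => gaussVec (Fin (m + 1))) :=
    measurePreserving_pi _ _ fun _ => measurePreserving_mulVec_gaussVec hU
  have he : detExp β N0 S u =
      (fun x => (Real.exp (-(N0 * r)) : ℂ) * tiltedMinor β N0 r 0 S id id x) ∘
      fun (x : ι → Fin (m + 1) → ℂ) n => U *ᵥ x n := by
    funext x
    rw [← detExp_mulVec β N0 S hU, hUu, Function.comp_apply, detExp_single β N0 S hr]
  have hi : Integrable (fun x => (Real.exp (-(N0 * r)) : ℂ) * tiltedMinor β N0 r 0 S id id x)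
      (Measure.pi fun _ : ι => gaussVec (Fin (m + 1))) :=
    (integrable_tiltedMinor N0 0 hβ hr S id id).const_mul _
  rw [he]
  refine ⟨hmp.integrable_comp_of_integrable hi, ?_⟩
  simp only [Function.comp_apply]
  have h := integral_map (μ := Measure.pi fun _ : ι => gaussVec (Fin (m + 1)))
    hmp.measurable.aemeasurable (by rw [hmp.map_eq]; exact hi.aestronglyMeasurable)
  rw [← h, hmp.map_eq, integral_const_mul, integral_tiltedMinor_of_mem_range N0 0 hβ hr S
    Function.injective_id (a := 0) rfl, ← Complex.ofReal_mul]

end Rotation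

/-! ### The law of the quadratic form -/

section Law

variable {ι κ : Type*} [Fintype κ] [DecidableEq κ]

open scoped ComplexOrder in
lemma noisyCov_posDef {β : ι → ℝ} (hβ : ∀ n, 0 ≤ β n) {N0 : ℝ} (hN0 : 0 < N0) (S : Finset ι)
    (x : ι → κ → ℂ) : (noisyCov β N0 S x).PosDef := by
  refine Matrix.PosDef.add_posSemidef ?_ ?_
  · exact Matrix.PosDef.one.smul (by exact_mod_cast hN0 : (0 : ℂ) < (N0 : ℂ))
  · exact Matrix.posSemidef_sum _ fun n _ => (Matrix.posSemidef_vecMulVec_self_star (x n)).smul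
      (by exact_mod_cast hβ n : (0 : ℂ) ≤ (β n : ℂ))

lemma genCoeff_nonneg {β : ι → ℝ} (hβ : ∀ n, 0 ≤ β n) {N0 : ℝ} (hN0 : 0 ≤ N0) (S : Finset ι)
    (m : ℕ) : 0 ≤ genCoeff β N0 S m :=
  Finset.sum_nonneg fun _ _ => mul_nonneg (by positivity)
    (Finset.sum_nonneg fun _ _ => Finset.prod_nonneg fun n _ => hβ n)

variable [DecidableEq ι]

lemma tiltCoeff_nonneg {β : ι → ℝ} (hβ : ∀ n, 0 ≤ β n) {N0 : ℝ} (hN0 : 0 ≤ N0) {r : ℝ} (hr : 0 ≤ r)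
    (S : Finset ι) (m : ℕ) : 0 ≤ tiltCoeff β N0 r S m := by
  refine add_nonneg (mul_nonneg hN0 (genCoeff_nonneg hβ hN0 S m)) (Finset.sum_nonneg fun n _ => ?_)
  have := hβ n
  exact mul_nonneg (by positivity) (genCoeff_nonneg hβ hN0 _ m)

lemma tailDensity_nonneg {β : ι → ℝ} (hβ : ∀ n, 0 ≤ β n) {N0 : ℝ} (hN0 : 0 ≤ N0) {r : ℝ}
    (hr : 0 ≤ r) (S : Finset ι) (m : ℕ) : 0 ≤ tailDensity β N0 S m r := by
  refine div_nonneg (mul_nonneg (by positivity) (tiltCoeff_nonneg hβ hN0 hr S m))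
    (Finset.prod_nonneg fun n _ => ?_)
  have := hβ n
  positivity

lemma continuousOn_tailDensity {β : ι → ℝ} (hβ : ∀ n, 0 ≤ β n) (N0 : ℝ) (S : Finset ι) (m : ℕ) :
    ContinuousOn (tailDensity β N0 S m) (Set.Ici 0) := by
  have hne : ∀ n, ∀ r ∈ Set.Ici (0 : ℝ), 1 + β n * r ≠ 0 := fun n r hr => by
    have := mul_nonneg (hβ n) hr; positivity
  unfold tailDensity tiltCoeff
  refine ContinuousOn.div ?_ (by fun_prop) fun r hr =>
    Finset.prod_ne_zero_iff.2 fun n _ => hne n r hr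
  refine ContinuousOn.mul (by fun_prop) (continuousOn_const.add
    (continuousOn_finsetSum _ fun n _ => ContinuousOn.mul ?_ continuousOn_const))
  exact ContinuousOn.div continuousOn_const (by fun_prop) (hne n)

lemma lintegral_tailDensity {β : ι → ℝ} (hβ : ∀ n, 0 ≤ β n) {N0 : ℝ} (hN0 : 0 ≤ N0) (S : Finset ι)
    (m : ℕ) {t : ℝ} (ht : 0 ≤ t) :
    ∫⁻ r in Set.Ioc 0 t, ENNReal.ofReal (tailDensity β N0 S m r) =
      ENNReal.ofReal (1 - tailFun β N0 S (m + 1) t) ∧ 0 ≤ 1 - tailFun β N0 S (m + 1) t := by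
  have hsub : Set.uIcc 0 t ⊆ Set.Ici 0 := by
    rw [Set.uIcc_of_le ht]; exact Set.Icc_subset_Ici_self
  have hint : IntervalIntegrable (tailDensity β N0 S m) volume 0 t :=
    ((continuousOn_tailDensity hβ N0 S m).mono hsub).intervalIntegrable
  have h0 : tailFun β N0 S (m + 1) 0 = 1 := by
    simp [tailFun, Finset.sum_range_succ']
  have h := intervalIntegral.integral_eq_sub_of_hasDerivAt
    (f := fun s => -tailFun β N0 S (m + 1) s) (f' := tailDensity β N0 S m) (a := 0) (b := t)
    (fun s hs => by
      have := (hasDerivAt_tailFun hβ N0 S m (hsub hs)).neg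
      rwa [neg_neg] at this) hint
  rw [h0] at h
  have h' : ∫ r in (0 : ℝ)..t, tailDensity β N0 S m r = 1 - tailFun β N0 S (m + 1) t := by
    rw [h]; ring
  refine ⟨?_, ?_⟩
  · rw [← h', intervalIntegral.integral_of_le ht, ofReal_integral_eq_lintegral_ofReal hint.1]
    exact (ae_restrict_iff' measurableSet_Ioc).2 (Filter.Eventually.of_forall fun r hr =>
      tailDensity_nonneg hβ hN0 hr.1.le S m)
  · rw [← h']
    exact intervalIntegral.integral_nonneg ht fun r hr => tailDensity_nonneg hβ hN0 hr.1 S m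

omit [Fintype κ] [DecidableEq ι] in
lemma noisyCov_congr (β : ι → ℝ) (N0 : ℝ) {S : Finset ι} {x y : ι → κ → ℂ}
    (h : ∀ n ∈ S, x n = y n) : noisyCov β N0 S x = noisyCov β N0 S y := by
  unfold noisyCov
  congr 1
  exact Finset.sum_congr rfl fun n hn => by rw [h n hn]

variable [Fintype ι]

omit [DecidableEq ι] in
/-- The matrix inverse is measurable because it is the adjugate divided by the determinant. -/
lemma measurable_invQuad (β : ι → ℝ) (N0 : ℝ) (S : Finset ι) :
    Measurable fun p : (ι → κ → ℂ) × (κ → ℂ) =>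
      (star p.2 ⬝ᵥ ((noisyCov β N0 S p.1)⁻¹ *ᵥ p.2)).re := by
  have hA : Continuous fun p : (ι → κ → ℂ) × (κ → ℂ) => noisyCov β N0 S p.1 :=
    (continuous_noisyCov β N0 S).comp continuous_fst
  have e : ∀ p : (ι → κ → ℂ) × (κ → ℂ), (star p.2 ⬝ᵥ ((noisyCov β N0 S p.1)⁻¹ *ᵥ p.2)).re =
      ((noisyCov β N0 S p.1).det⁻¹ *
        (star p.2 ⬝ᵥ ((noisyCov β N0 S p.1).adjugate *ᵥ p.2))).re := by
    intro p
    rw [Matrix.inv_def, Ring.inverse_eq_inv', Matrix.smul_mulVec, dotProduct_smul, smul_eq_mul]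
  simp_rw [e]
  refine Complex.measurable_re.comp (Measurable.mul ?_ ?_)
  · exact (hA.matrix_det.measurable).inv
  · exact (Continuous.dotProduct continuous_snd.star
      (Continuous.matrix_mulVec hA.matrix_adjugate continuous_snd)).measurable

omit [Fintype ι] [DecidableEq ι] in
lemma continuous_detExp (β : ι → ℝ) (N0 : ℝ) (S : Finset ι) :
    Continuous fun p : (ι → κ → ℂ) × (κ → ℂ) => (noisyCov β N0 S p.1).det.re *
      Real.exp (-(star p.2 ⬝ᵥ (noisyCov β N0 S p.1 *ᵥ p.2)).re) := by
  have hA : Continuous fun p : (ι → κ → ℂ) × (κ → ℂ) => noisyCov β N0 S p.1 :=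
    (continuous_noisyCov β N0 S).comp continuous_fst
  exact (Complex.continuous_re.comp hA.matrix_det).mul (Real.continuous_exp.comp
    (Complex.continuous_re.comp (Continuous.dotProduct continuous_snd.star
      (Continuous.matrix_mulVec hA continuous_snd))).neg)

/-- Conditioning on the columns in `S`: the column `i` is independent of them. -/
lemma measure_invQuad_le_eq_lintegral {β : ι → ℝ} (N0 : ℝ) {S : Finset ι} {i : ι} (hi : i ∉ S)
    (t : ℝ) :
    (Measure.pi fun _ : ι => gaussVec κ)
        {x | (star (x i) ⬝ᵥ ((noisyCov β N0 S x)⁻¹ *ᵥ x i)).re ≤ t} =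
      ∫⁻ x, gaussVec κ {c | (star c ⬝ᵥ ((noisyCov β N0 S x)⁻¹ *ᵥ c)).re ≤ t}
        ∂(Measure.pi fun _ : ι => gaussVec κ) := by
  set P := Measure.pi fun _ : ι => gaussVec κ with hP
  -- `Y` keeps the columns in `S`, the only ones on which `noisyCov β N0 S` depends.
  let Y : (ι → κ → ℂ) → ι → κ → ℂ := fun x j => if j ∈ S then x j else 0
  have hY : Measurable Y := measurable_piecewise_zero S
  have hXi : Measurable fun x : ι → κ → ℂ => x i := measurable_pi_apply i
  have hind : IndepFun Y (fun x => x i) P := indepFun_piecewise_eval hi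
  have hmap := (indepFun_iff_map_prod_eq_prod_map_map hY.aemeasurable hXi.aemeasurable).1 hind
  have hlaw : P.map (fun x => x i) = gaussVec κ :=
    (measurePreserving_eval (fun _ : ι => gaussVec κ) i).map_eq
  have hYcov : ∀ x, noisyCov β N0 S (Y x) = noisyCov β N0 S x := fun x =>
    noisyCov_congr β N0 fun n hn => by simp [Y, hn]
  let E : Set ((ι → κ → ℂ) × (κ → ℂ)) :=
    {p | (star p.2 ⬝ᵥ ((noisyCov β N0 S p.1)⁻¹ *ᵥ p.2)).re ≤ t}
  have hE : MeasurableSet E := measurableSet_le (measurable_invQuad β N0 S) measurable_const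
  have h1 : {x : ι → κ → ℂ | (star (x i) ⬝ᵥ ((noisyCov β N0 S x)⁻¹ *ᵥ x i)).re ≤ t} =
      (fun x => (Y x, x i)) ⁻¹' E := by
    ext x
    simp only [E, Set.mem_preimage, Set.mem_ofPred_eq, hYcov]
  have hsec : Measurable fun x => gaussVec κ (Prod.mk x ⁻¹' E) := measurable_measure_prodMk_left hE
  rw [h1, ← Measure.map_apply (hY.prodMk hXi) hE, hmap, hlaw, Measure.prod_apply hE,
    lintegral_map hsec hY]
  refine lintegral_congr fun x => ?_
  congr 1
  ext c
  simp only [E, Set.mem_preimage, Set.mem_ofPred_eq, hYcov]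

open scoped ComplexOrder in
lemma lintegral_detExp {m : ℕ} {β : ι → ℝ} (hβ : ∀ n, 0 ≤ β n) {N0 : ℝ} (hN0 : 0 < N0)
    (S : Finset ι) (u : Fin (m + 1) → ℂ) :
    ∫⁻ x, ENNReal.ofReal ((Real.pi ^ (m + 1))⁻¹ * ((noisyCov β N0 S x).det.re *
        Real.exp (-(star u ⬝ᵥ (noisyCov β N0 S x *ᵥ u)).re)))
        ∂(Measure.pi fun _ : ι => gaussVec (Fin (m + 1))) =
      ENNReal.ofReal ((Real.pi ^ (m + 1))⁻¹ * (Real.exp (-(N0 * ∑ a, ‖u a‖ ^ 2)) *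
        ((∏ n ∈ S, (1 + β n * ∑ a, ‖u a‖ ^ 2)⁻¹) *
          (m.factorial * tiltCoeff β N0 (∑ a, ‖u a‖ ^ 2) S m)))) := by
  obtain ⟨hi, hv⟩ := integrable_and_integral_detExp hβ N0 S u
  have hre : ∀ x, (noisyCov β N0 S x).det.re *
        Real.exp (-(star u ⬝ᵥ (noisyCov β N0 S x *ᵥ u)).re) = (detExp β N0 S u x).re := by
    intro x
    rw [detExp, Complex.re_mul_ofReal]
  have hnn : ∀ x, 0 ≤ (detExp β N0 S u x).re := by
    intro x
    rw [← hre]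
    exact mul_nonneg (Complex.le_def.1 (noisyCov_posDef hβ hN0 S x).det_pos.le).1
      (Real.exp_pos _).le
  have hire : Integrable (fun x => (detExp β N0 S u x).re)
    (Measure.pi fun _ : ι => gaussVec (Fin (m + 1))) := hi.re
  simp_rw [hre]
  rw [← ofReal_integral_eq_lintegral_ofReal (hire.const_mul _)
    (Filter.Eventually.of_forall fun x => mul_nonneg (by positivity) (hnn x)), integral_const_mul]
  congr 2
  have := integral_re hi
  simp only [RCLike.re_to_complex] at this
  exact this.trans (by rw [hv, Complex.ofReal_re])

lemma measure_invQuad_le {m : ℕ} {β : ι → ℝ} (hβ : ∀ n, 0 ≤ β n) {N0 : ℝ} (hN0 : 0 < N0)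
    {S : Finset ι} {i : ι} (hi : i ∉ S) {t : ℝ} (ht : 0 ≤ t) :
    (Measure.pi fun _ : ι => gaussVec (Fin (m + 1))).real
        {x | (star (x i) ⬝ᵥ ((noisyCov β N0 S x)⁻¹ *ᵥ x i)).re ≤ t} =
      1 - tailFun β N0 S (m + 1) t := by
  obtain ⟨hlint, hnn⟩ := lintegral_tailDensity hβ hN0.le S m ht
  rw [Measure.real, ← ENNReal.toReal_ofReal hnn, ← hlint]
  congr 1
  rw [measure_invQuad_le_eq_lintegral N0 hi t, lintegral_congr fun x =>
    gaussVec_quadForm_inv_le (noisyCov_posDef hβ hN0 S x) t, Fintype.card_fin,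
    lintegral_lintegral_swap, lintegral_congr fun u => lintegral_detExp hβ hN0 S u]
  · have hf : Measurable fun r : ℝ => ENNReal.ofReal ((Real.pi ^ (m + 1))⁻¹ *
        (Real.exp (-(N0 * r)) * ((∏ n ∈ S, (1 + β n * r)⁻¹) *
          (m.factorial * tiltCoeff β N0 r S m)))) := by
      unfold tiltCoeff
      fun_prop
    rw [lintegral_sum_norm_sq hf t, Fintype.card_fin, Nat.add_sub_cancel]
    refine setLIntegral_congr_fun measurableSet_Ioc fun r hr => ?_
    have hr0 : 0 < r := hr.1
    rw [← ENNReal.ofReal_mul (by positivity), tailDensity, Finset.prod_inv_distrib]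
    congr 1
    have : (m.factorial : ℝ) ≠ 0 := by positivity
    have : Real.pi ≠ 0 := Real.pi_ne_zero
    rw [div_eq_mul_inv (_ * _ * _)]
    generalize (∏ n ∈ S, (1 + β n * r))⁻¹ = q
    field_simp
  · exact (((continuous_detExp β N0 S).const_mul _).measurable.ennreal_ofReal).aemeasurable

end Law

/-! ### The Rayleigh fading model -/

section Model

variable {N M : ℕ}

/-- The columns of a Rayleigh matrix are independent Gaussian vectors. -/
lemma IsRayleighMatrix.map_columns {Ω : Type*} [MeasurableSpace Ω] {P : Measure Ω}
    [IsProbabilityMeasure P] {C : Ω → Matrix (Fin N) (Fin M) ℂ} (hC : IsRayleighMatrix P C) :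
    AEMeasurable (fun ω (j : Fin M) (a : Fin N) => C ω a j) P ∧
    P.map (fun ω (j : Fin M) (a : Fin N) => C ω a j) =
      Measure.pi fun _ : Fin M => gaussVec (Fin N) := by
  have hm : ∀ (p : Fin M × Fin N), AEMeasurable (fun ω => C ω p.2 p.1) P := fun p =>
    (hC.1 p.2 p.1).aemeasurable
  have hind : iIndepFun (fun (p : Fin M × Fin N) ω => C ω p.2 p.1) P :=
    hC.2.precomp (g := Prod.swap) Prod.swap_injective
  have hmap := (iIndepFun_iff_map_fun_eq_pi_map hm).1 hind
  have hlaw : ∀ p : Fin M × Fin N, P.map (fun ω => C ω p.2 p.1) = complexGaussian 1 := fun p =>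
    (hC.1 p.2 p.1).map_eq
  simp_rw [hlaw] at hmap
  have hmeas : AEMeasurable (fun ω (p : Fin M × Fin N) => C ω p.2 p.1) P :=
    aemeasurable_pi_lambda _ hm
  refine ⟨aemeasurable_pi_lambda _ fun j => aemeasurable_pi_lambda _ fun a => hm (j, a), ?_⟩
  have e : (fun ω (j : Fin M) (a : Fin N) => C ω a j) =
      MeasurableEquiv.curry (Fin M) (Fin N) ℂ ∘ fun ω (p : Fin M × Fin N) => C ω p.2 p.1 := by
    funext ω j a; rfl
  have hcurry := Measure.infinitePi_map_curry (fun (_ : Fin M) (_ : Fin N) => complexGaussian 1)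
  simp only [Measure.infinitePi_eq_pi] at hcurry
  rw [e, ← AEMeasurable.map_map_of_aemeasurable (MeasurableEquiv.measurable _).aemeasurable hmeas,
    hmap, hcurry]
  rfl

lemma interfMatrix_eq_noisyCov (β : Fin M → ℝ) (N0 : ℝ) (i : Fin M)
    (C : Matrix (Fin N) (Fin M) ℂ) :
    interfMatrix β N0 i C = noisyCov β N0 (Finset.univ.erase i) fun j a => C a j := by
  ext a b
  rw [interfMatrix, noisyCov, Matrix.add_apply, Matrix.add_apply, add_comm, Matrix.sum_apply]
  congr 1
  rw [Matrix.mul_apply, Finset.sum_subtype (p := fun j => j ≠ i) _ (by simp)]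
  refine Finset.sum_congr rfl fun j _ => ?_
  rw [Matrix.mul_diagonal]
  simp [Matrix.vecMulVec_apply]
  ring

lemma covMatrix_eq_noisyCov (β : Fin M → ℝ) (N0 : ℝ) (C : Matrix (Fin N) (Fin M) ℂ) :
    covMatrix β N0 C = noisyCov β N0 Finset.univ fun j a => C a j := by
  ext a b
  rw [covMatrix, noisyCov, Matrix.add_apply, Matrix.add_apply, add_comm, Matrix.sum_apply]
  congr 1
  rw [Matrix.mul_apply]
  refine Finset.sum_congr rfl fun j _ => ?_
  rw [Matrix.mul_diagonal]
  simp [Matrix.vecMulVec_apply]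
  ring

lemma covMatrix_eq_interfMatrix_add (β : Fin M → ℝ) (N0 : ℝ) (i : Fin M)
    (C : Matrix (Fin N) (Fin M) ℂ) :
    covMatrix β N0 C = interfMatrix β N0 i C +
      (β i : ℂ) • Matrix.vecMulVec (fun a => C a i) (star fun a => C a i) := by
  rw [covMatrix_eq_noisyCov, interfMatrix_eq_noisyCov,
    ← noisyCov_insert _ _ (Finset.notMem_erase i _),
    Finset.insert_erase (Finset.mem_univ i)]

open scoped ComplexOrder in
lemma invQuadForm_nonneg {B : Matrix (Fin N) (Fin N) ℂ} (hB : B.PosDef) (c : Fin N → ℂ) :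
    0 ≤ invQuadForm B c :=
  (Complex.le_def.1 (hB.inv.posSemidef.dotProduct_mulVec_nonneg c)).1

open scoped ComplexOrder in
/-- The Sherman–Morrison formula for the quadratic form. -/
lemma invQuadForm_add_vecMulVec {B : Matrix (Fin N) (Fin N) ℂ} (hB : B.PosDef) {b : ℝ} (hb : 0 ≤ b)
    (c : Fin N → ℂ) :
    invQuadForm (B + (b : ℂ) • Matrix.vecMulVec c (star c)) c =
      invQuadForm B c / (1 + b * invQuadForm B c) := by
  set A := B + (b : ℂ) • Matrix.vecMulVec c (star c) with hA
  have hApd : A.PosDef := hB.add_posSemidef ((Matrix.posSemidef_vecMulVec_self_star c).smul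
    (by exact_mod_cast hb : (0 : ℂ) ≤ (b : ℂ)))
  have hq0 := invQuadForm_nonneg hB c
  have hqC : star c ⬝ᵥ (B⁻¹ *ᵥ c) = (invQuadForm B c : ℂ) := by
    have him := (Complex.le_def.1 (hB.inv.posSemidef.dotProduct_mulVec_nonneg c)).2
    exact Complex.ext rfl (by simpa using him.symm)
  generalize invQuadForm B c = q at *
  have hpos : 0 < 1 + b * q := by positivity
  have hposC : (1 + b * q : ℂ) ≠ 0 := by exact_mod_cast hpos.ne'
  have hBu : IsUnit B.det := isUnit_iff_ne_zero.2 hB.det_pos.ne'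
  have hAu : IsUnit A.det := isUnit_iff_ne_zero.2 hApd.det_pos.ne'
  have hAv : A *ᵥ (B⁻¹ *ᵥ c) = (1 + b * q : ℂ) • c := by
    rw [hA, Matrix.add_mulVec, Matrix.mulVec_mulVec, Matrix.mul_nonsing_inv _ hBu,
      Matrix.one_mulVec, Matrix.smul_mulVec, Matrix.vecMulVec_mulVec, hqC, add_smul, one_smul,
      mul_smul]
    congr 2
    ext a
    simp [mul_comm]
  have hAc : A⁻¹ *ᵥ c = (1 + b * q : ℂ)⁻¹ • (B⁻¹ *ᵥ c) := by
    have h : B⁻¹ *ᵥ c = (1 + b * q : ℂ) • (A⁻¹ *ᵥ c) := by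
      rw [← Matrix.mulVec_smul, ← hAv, Matrix.mulVec_mulVec, Matrix.nonsing_inv_mul _ hAu,
        Matrix.one_mulVec]
    rw [h, smul_smul, inv_mul_cancel₀ hposC, one_smul]
  rw [invQuadForm, hAc, dotProduct_smul, hqC, smul_eq_mul, mul_comm, ← div_eq_mul_inv]
  have : (q : ℂ) / (1 + b * q) = ((q / (1 + b * q) : ℝ) : ℂ) := by push_cast; rfl
  rw [this, Complex.ofReal_re]

variable {β : Fin M → ℝ} {N0 : ℝ}

open scoped ComplexOrder in
lemma interfMatrix_posDef (hβ : ∀ j, 0 < β j) (hN0 : 0 < N0) (i : Fin M)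
    (C : Matrix (Fin N) (Fin M) ℂ) : (interfMatrix β N0 i C).PosDef := by
  rw [interfMatrix_eq_noisyCov]
  exact noisyCov_posDef (fun j => (hβ j).le) hN0 _ _

lemma phiStat_nonneg (hβ : ∀ j, 0 < β j) (hN0 : 0 < N0) (i : Fin M)
    (C : Matrix (Fin N) (Fin M) ℂ) : 0 ≤ phiStat β N0 i C :=
  mul_nonneg (hβ i).le (invQuadForm_nonneg (interfMatrix_posDef hβ hN0 i C) _)

lemma approxSINR_eq (hβ : ∀ j, 0 < β j) (hN0 : 0 < N0) (α : ℝ) (i : Fin M)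
    (C : Matrix (Fin N) (Fin M) ℂ) :
    approxSINR β N0 α i C =
      sinrCeiling β N0 α i * phiStat β N0 i C / (1 + phiStat β N0 i C) := by
  have hi := (hβ i).ne'
  rw [approxSINR, covMatrix_eq_interfMatrix_add β N0 i, invQuadForm_add_vecMulVec
    (interfMatrix_posDef hβ hN0 i C) (hβ i).le, sinrCeiling, phiStat, div_pow]
  field_simp

lemma approxSINR_le_iff (hβ : ∀ j, 0 < β j) (hN0 : 0 < N0) (α : ℝ) (i : Fin M)
    (C : Matrix (Fin N) (Fin M) ℂ) {x : ℝ} (hx : x < sinrCeiling β N0 α i) :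
    approxSINR β N0 α i C ≤ x ↔ phiStat β N0 i C ≤ x / (sinrCeiling β N0 α i - x) := by
  have h0 := phiStat_nonneg hβ hN0 i C
  rw [approxSINR_eq hβ hN0, div_le_iff₀ (by linarith), le_div_iff₀ (by linarith)]
  constructor <;> intro h <;> linarith

lemma approxSINR_le_sinrCeiling (hβ : ∀ j, 0 < β j) (hN0 : 0 < N0) (α : ℝ) (i : Fin M)
    (C : Matrix (Fin N) (Fin M) ℂ) : approxSINR β N0 α i C ≤ sinrCeiling β N0 α i := by
  have h0 := phiStat_nonneg hβ hN0 i C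
  have h1 : 0 ≤ sinrCeiling β N0 α i := sq_nonneg _
  rw [approxSINR_eq hβ hN0, div_le_iff₀ (by linarith)]
  linarith

lemma measureReal_phiStat_le {Ω : Type*} [MeasurableSpace Ω] {P : Measure Ω}
    [IsProbabilityMeasure P] (hβ : ∀ j, 0 < β j) (hN0 : 0 < N0)
    {C : Ω → Matrix (Fin N) (Fin M) ℂ} (hC : IsRayleighMatrix P C) (i : Fin M) {y : ℝ}
    (hy : 0 ≤ y) : P.real {ω | phiStat β N0 i (C ω) ≤ y} = phiCDF N β N0 i y := by
  rw [phiCDF_eq_tailFun N hβ N0 i hy]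
  cases N with
  | zero =>
    have : {ω | phiStat β N0 i (C ω) ≤ y} = Set.univ := by
      ext ω
      simpa [phiStat, invQuadForm] using hy
    rw [this, tailFun_zero]
    simp
  | succ m =>
    have ht : 0 ≤ y / β i := div_nonneg hy (hβ i).le
    obtain ⟨hmeas, hmap⟩ := hC.map_columns
    have hE : MeasurableSet {x : Fin M → Fin (m + 1) → ℂ | (star (x i) ⬝ᵥ
        ((noisyCov β N0 (Finset.univ.erase i) x)⁻¹ *ᵥ x i)).re ≤ y / β i} :=
      measurableSet_le ((measurable_invQuad β N0 (Finset.univ.erase i)).comp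
        (measurable_id.prodMk (measurable_pi_apply i))) measurable_const
    rw [← measure_invQuad_le (fun j => (hβ j).le) hN0 (Finset.notMem_erase i _) ht, ← hmap,
      measureReal_def, measureReal_def, Measure.map_apply_of_aemeasurable hmeas hE]
    congr 2
    ext ω
    simp only [Set.mem_preimage, Set.mem_ofPred_eq, phiStat, interfMatrix_eq_noisyCov, invQuadForm]
    rw [le_div_iff₀ (hβ i), mul_comm]

end Model

end

theorem lemma1 {Ω : Type*} [MeasurableSpace Ω] (P : Measure Ω) [IsProbabilityMeasure P]
    {N M : ℕ} (β : Fin M → ℝ) (hβ : ∀ j, 0 < β j) (N0 : ℝ) (hN0 : 0 < N0) (α : ℝ)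
    (C : Ω → Matrix (Fin N) (Fin M) ℂ) (hC : IsRayleighMatrix P C) (i : Fin M) :
    (∀ x, x < sinrCeiling β N0 α i →
      P.real {ω | approxSINR β N0 α i (C ω) ≤ x} =
        P.real {ω | phiStat β N0 i (C ω) ≤ x / (sinrCeiling β N0 α i - x)}) ∧
    (∀ x, sinrCeiling β N0 α i ≤ x → P.real {ω | approxSINR β N0 α i (C ω) ≤ x} = 1) ∧
    (∀ y, 0 ≤ y → P.real {ω | phiStat β N0 i (C ω) ≤ y} = phiCDF N β N0 i y) ∧
    (∀ y, y < 0 → P.real {ω | phiStat β N0 i (C ω) ≤ y} = 0) ∧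
    (∀ b, (∀ j, β j = b) → ∀ y, 0 ≤ y →
      phiCDF N β N0 i y = phiCDFiid N M b N0 y ∧
      P.real {ω | phiStat β N0 i (C ω) ≤ y} = phiCDFiid N M b N0 y) := by
  refine ⟨fun x hx => ?_, fun x hx => ?_, fun y hy => measureReal_phiStat_le hβ hN0 hC i hy,
    fun y hy => ?_, fun b hb y hy => ?_⟩
  · simp only [approxSINR_le_iff hβ hN0 α i _ hx]
  · have : {ω | approxSINR β N0 α i (C ω) ≤ x} = Set.univ :=
      Set.eq_univ_of_forall fun ω => (approxSINR_le_sinrCeiling hβ hN0 α i (C ω)).trans hx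
    rw [this]
    simp
  · have : {ω | phiStat β N0 i (C ω) ≤ y} = ∅ :=
      Set.eq_empty_of_forall_notMem fun ω h =>
        absurd (phiStat_nonneg hβ hN0 i (C ω)) (not_le.2 (lt_of_le_of_lt h hy))
    rw [this]
    simp
  · have hiid := phiCDF_eq_phiCDFiid N (hb i ▸ (hβ i).ne') hb N0 i y
    exact ⟨hiid, (measureReal_phiStat_le hβ hN0 hC i hy).trans hiid⟩
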